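/- Let $B>0$ and let $V:\mathbb{R}^2\to\mathbb{R}$ be measurable. Let $$H_B=\Big(-i\frac{\partial}{\partial x_1}+\frac{Bx_2}{2}\Big)^2+\Big(-i\frac{\partial}{\partial x_2}-\frac{Bx_1}{2}\Big)^2$$ be the Landau Hamiltonian in $L^2(\mathbb{R}^2)$, and let $H_B+V$ be the operator associated with the quadratic form $$u\mapsto\int_{\mathbb{R}^2}\Big(\big|(-i\partial_1+\tfrac{Bx_2}{2})u\big|^2+\big|(-i\partial_2-\tfrac{Bx_1}{2})u\big|^2+V|u|^2\Big)\,dx$$ on the set of all $u\in L^2(\mathbb{R}^2)$ for which $(-i\partial_1+\frac{Bx_2}{2})u$ and $(-i\partial_2-\frac{Bx_1}{2})u$ (in the sense of distributions) belong to $L^2(\mathbb{R}^2)$ and $\int|V||u|^2\,dx<\infty$. Write $t_-=\max(-t,0)$. Then $$\mathrm{Tr}\,(H_B+V)_-\le 3\cdot\frac{B}{2\pi}\sum_{m=0}^{\infty}\int_{\mathbb{R}^2}\big((2m+1)B+V(x)\big)_-\,dx .$$ Both sides take values in $[0,\infty]$. The left side is the trace of the negative part of $H_B+V$ (when finite, the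 sum of the absolute values of the negative eigenvalues, counted with multiplicity), and it is set to be $\infty$ if $H_B+V$ is not self-adjoint and bounded from below; so the inequality includes the assertion that $H_B+V$ is self-adjoint and bounded from below whenever the right side is finite. (If the form domain is not dense, $H_B+V$ is understood as an operator in its closure.) -/

import Mathlib

open MeasureTheory
open scoped ENNReal ContDiff ComplexConjugate

noncomputable section

/-! ### Negative part of a lower semibounded self-adjoint operator -/

section NegPart

variable {H : Type*} [NormedAddCommGroup H] [InnerProductSpace ℂ H] [CompleteSpace H]

/-- For an operator `A` on `H` with graph `G`, the bounded operator `R` is `(A + c)⁻¹` and it is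
positive. Such `c` and `R` exist exactly when `A` is self-adjoint and bounded from below.
(If `A` is self-adjoint only in a closed subspace `K` of `H`, its graph is completed by
`{0} × Kᗮ`, and then `R` vanishes on `Kᗮ`.) -/
def IsShiftedInverse (G : Set (H × H)) (c : ℝ) (R : H →L[ℂ] H) : Prop :=
  R.IsPositive ∧ ∀ f u : H, (u, f - (c : ℂ) • u) ∈ G ↔ R f = u

/-- The negative part `A₋` of `A`, as a function of `R = (A + c)⁻¹` in the continuous functional
calculus: the spectral value `t = (a + c)⁻¹` of `R` is sent to `max (c - 1 / t) 0 = max (-a) 0`,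
written so that `t = 0` is sent to `0`. -/
def negPartOfShiftedInverse (c : ℝ) (R : H →L[ℂ] H) : H →L[ℂ] H :=
  cfc (fun t : ℝ => max (c * t - 1) 0 / t) R

open Classical in
/-- The trace `Tr A₋ ∈ [0, ∞]` of the negative part of the operator `A` with graph `G`, computed
in the Hilbert basis `b`. The negative part does not depend on the choice of the shift `c`.
The value is `∞` if `A` is not self-adjoint and bounded from below. -/
def traceNegPart {ι : Type*} (b : HilbertBasis ι ℂ H) (G : Set (H × H)) : ℝ≥0∞ :=
  if h : ∃ p : ℝ × (H →L[ℂ] H), IsShiftedInverse G p.1 p.2 then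
    ∑' i, ENNReal.ofReal
      (inner ℂ (b i) (negPartOfShiftedInverse h.choose.1 h.choose.2 (b i))).re
  else ⊤

end NegPart

/-! ### The operator `H_B + V` -/

/-- The Euclidean plane. -/
abbrev Plane : Type := EuclideanSpace ℝ (Fin 2)

/-- The complex Hilbert space `L²(ℝ²)`. -/
abbrev L2Plane : Type := Lp ℂ 2 (volume : Measure Plane)

/-- The vector potential `(B x₂ / 2, - B x₁ / 2)` (coordinates are numbered `0`, `1`). -/
def landauPotential (B : ℝ) (x : Plane) : Fin 2 → ℝ :=
  ![B * x 1 / 2, -(B * x 0 / 2)]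

/-- The first order operators `-i ∂₁ + B x₂ / 2` and `-i ∂₂ - B x₁ / 2` on smooth functions. -/
def magDeriv (B : ℝ) (j : Fin 2) (φ : Plane → ℂ) (x : Plane) : ℂ :=
  -Complex.I * fderiv ℝ φ x (EuclideanSpace.single j 1) + (landauPotential B x j : ℂ) * φ x

/-- `g` is the `j`-th magnetic derivative of `u` in the sense of distributions. -/
def IsWeakMagDeriv (B : ℝ) (j : Fin 2) (u g : L2Plane) : Prop :=
  ∀ φ : Plane → ℂ, ContDiff ℝ ∞ φ → HasCompactSupport φ →
    ∫ x, conj (magDeriv B j φ x) * u x = ∫ x, conj (φ x) * g x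

open Classical in
/-- The (unique) weak magnetic derivative in `L²(ℝ²)`, where it exists. -/
def weakMagDeriv (B : ℝ) (j : Fin 2) (u : L2Plane) : L2Plane :=
  if h : ∃ g, IsWeakMagDeriv B j u g then h.choose else 0

/-- The form domain of `H_B + V`: all `u ∈ L²(ℝ²)` whose weak magnetic derivatives are in
`L²(ℝ²)` and for which `∫ |V| |u|² < ∞`. -/
def formDomain (B : ℝ) (V : Plane → ℝ) : Set L2Plane :=
  {u | (∀ j, ∃ g, IsWeakMagDeriv B j u g) ∧ Integrable (fun x => V x * ‖u x‖ ^ 2) volume}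

/-- The sesquilinear form of `H_B + V`. -/
def landauForm (B : ℝ) (V : Plane → ℝ) (v u : L2Plane) : ℂ :=
  ∑ j, inner ℂ (weakMagDeriv B j v) (weakMagDeriv B j u) +
    ∫ x, (V x : ℂ) * (conj (v x) * u x)

/-- The graph of `H_B + V`, the operator of the form `landauForm B V` on `formDomain B V`:
`(H_B + V) u = f` when `u` is in the form domain and the form of `v` and `u` is `⟪v, f⟫` for all
`v` in the form domain. -/
def landauGraph (B : ℝ) (V : Plane → ℝ) : Set (L2Plane × L2Plane) :=
  {p | p.1 ∈ formDomain B V ∧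
    ∀ v ∈ formDomain B V, landauForm B V v p.1 = inner ℂ v p.2}

end

/-! ### The scalar inequality -/

/-! The proof is Rumin's method: a kinetic energy inequality in terms of the density, then a
Legendre duality.

Kinetic part. On the `m`-th Landau level `H_B` equals `(2m+1)B`, so `H_B = B + 2B ∑_{n ≥ 1} (1 -
P_n)` with `P_n` the projection onto the first `n` levels. Let `γ = ∑ |ψ i⟩⟨ψ i| ≤ 1` have density
`ρ`. Each level has density at most `B/2π` at every point, so `P_n γ P_n` has density at most
`nB/2π`. The triangle inequality in `ℓ²` at each point then bounds the density of `(1 - P_n) γ (1 -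
P_n)` below by `(√ρ - √(nB/2π))₊²`. Summation gives `Tr H_B γ ≥ ∫ (Bρ + 2B ∑_n (√ρ - √(nB/2π))₊²)`,
which is `kinetic_energy_le`. The levels are made explicit by complex Hermite polynomials times a
Gaussian: ladder relations give orthogonality and the energies, `sum_norm_landauFun_le` bounds the
density, and `ae_eq_zero_of_integral_landauFun_eq_zero` gives completeness.

Duality. With `y = -V/B` and `r = 2πρ/B`, the scalar inequality `mul_le_levels` bounds `-Vρ` by the
kinetic density plus `3 (B/2π) ∑_m ((2m+1)B + V)₋`. The constant 3 enters there. Integration gives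
`lintegral_neg_potential_le`.

Operator part. A one-element family, with `2V + B` in place of `V`, shows that `V₋` has relative
form bound 1/2. Hence the shifted form is coercive on its closed domain and the resolvent exists
(`exists_isShiftedInverse`). For the trace, the families are `ψ i = K (b i)`, where `K` is a
continuous cutoff to the negative spectrum, a function of the resolvent (`exists_cutoff_operators`,
`sum_negPart_le`). -/

theorem sum_sqrt_le (N : ℕ) (hN : 1 ≤ N) :
    ∑ n ∈ Finset.range N, √((n : ℝ) + 1) ≤ 2 / 3 * √N ^ 3 + √N / 2 - 1 / 6 := by
  induction N, hN using Nat.le_induction with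
  | base => norm_num
  | succ N hN ih =>
    rw [Finset.sum_range_succ]
    push_cast
    set p := √(N : ℝ) with hp
    set q := √((N : ℝ) + 1) with hq
    have hp2 : p ^ 2 = N := Real.sq_sqrt (by positivity)
    have hq2 : q ^ 2 = N + 1 := Real.sq_sqrt (by positivity)
    have hp0 : 0 ≤ p := Real.sqrt_nonneg _
    have hq0 : 0 < q := Real.sqrt_pos.2 (by positivity)
    -- Trapezoidal rule for a concave function: the right side is the integral of `√t` from `N` to
    -- `N + 1`. The constant `-1/6` in the statement gives equality at `N = 1`.
    have key : (p + q) / 2 ≤ 2 / 3 * (q ^ 3 - p ^ 3) := by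
      have h1 : q ^ 3 - p ^ 3 = (q - p) * (q ^ 2 + p * q + p ^ 2) := by ring
      have h2 : (q - p) * (q + p) = 1 := by nlinarith
      have h3 : (p + q) * ((p + q) / 2) ≤ (p + q) * (2 / 3 * (q ^ 3 - p ^ 3)) := by
        rw [h1]
        have : (p + q) * (2 / 3 * ((q - p) * (q ^ 2 + p * q + p ^ 2))) =
          2 / 3 * ((q - p) * (q + p)) * (q ^ 2 + p * q + p ^ 2) := by ring
        rw [this, h2]
        nlinarith [sq_nonneg (p - q)]
      exact le_of_mul_le_mul_left h3 (by positivity)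
    linarith

/-- The sum `∑ (√r - √n)₊²` over `n = 1, …, N`. -/
noncomputable def sqrtGapSum (N : ℕ) (r : ℝ) : ℝ :=
  ∑ n ∈ Finset.range N, max (√r - √((n : ℝ) + 1)) 0 ^ 2

theorem sqrtGapSum_nonneg (N : ℕ) (r : ℝ) : 0 ≤ sqrtGapSum N r :=
  Finset.sum_nonneg fun _ _ => by positivity

theorem sqrtGapSum_mono {N M : ℕ} (h : N ≤ M) (r : ℝ) : sqrtGapSum N r ≤ sqrtGapSum M r :=
  Finset.sum_le_sum_of_subset_of_nonneg (Finset.range_mono h) fun _ _ _ => by positivity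

/-- Put `s = √r` and `p = √N`. Expanding the squares and inserting `sum_sqrt_le` leaves `s⁴/6 - s²/2
+ s/3 + (s-p)²/2 - (s-p)³(s+3p)/6`. The last two terms have a nonnegative sum because `s² - p² ≤ 1`,
and `s/3 ≥ 3/8` for `s ≥ 9/8`. -/
theorem sqrtGapSum_floor_ge {r : ℝ} (hr : 3 ≤ r) :
    r ^ 2 / 6 - r / 2 + 3 / 8 ≤ sqrtGapSum ⌊r⌋₊ r := by
  set N := ⌊r⌋₊ with hN
  have hr0 : 0 ≤ r := by linarith
  have hNr : (N : ℝ) ≤ r := Nat.floor_le hr0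
  have hrN : r < N + 1 := Nat.lt_floor_add_one r
  have hN1 : 1 ≤ N := Nat.le_floor (by push_cast; linarith)
  have hS := sum_sqrt_le N hN1
  set s := √r with hs
  set p := √(N : ℝ) with hp
  have hs2 : s ^ 2 = r := Real.sq_sqrt hr0
  have hp2 : p ^ 2 = N := Real.sq_sqrt (by positivity)
  have hp0 : 0 ≤ p := Real.sqrt_nonneg _
  have hps : p ≤ s := Real.sqrt_le_sqrt hNr
  have hs9 : 9 / 8 ≤ s := Real.le_sqrt_of_sq_le (by norm_num; linarith)
  have hsum : sqrtGapSum N r = N * r - 2 * s * ∑ n ∈ Finset.range N, √((n : ℝ) + 1)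
      + (N : ℝ) * (N + 1) / 2 := by
    have h1 : sqrtGapSum N r = ∑ n ∈ Finset.range N, (r - 2 * s * √((n : ℝ) + 1) + (n + 1)) := by
      refine Finset.sum_congr rfl fun n hn => ?_
      have hn' : (n : ℝ) + 1 ≤ N := by exact_mod_cast Finset.mem_range.1 hn
      have : √((n : ℝ) + 1) ≤ s := Real.sqrt_le_sqrt (hn'.trans hNr)
      rw [max_eq_left (by linarith), sub_sq, hs2, Real.sq_sqrt (by positivity)]
    have h2 : ∑ n ∈ Finset.range N, ((n : ℝ) + 1) = (N : ℝ) * (N + 1) / 2 := by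
      clear_value N
      clear * -
      induction N with
      | zero => simp
      | succ N ih => rw [Finset.sum_range_succ, ih]; push_cast; ring
    rw [h1, Finset.sum_add_distrib, Finset.sum_sub_distrib, ← Finset.mul_sum, h2]
    simp
  rw [hsum]
  have h3 : 2 * s * ∑ n ∈ Finset.range N, √((n : ℝ) + 1) ≤
      2 * s * (2 / 3 * p ^ 3 + p / 2 - 1 / 6) := by
    gcongr
  have h4 : (s - p) * (s + p) ≤ 1 := by nlinarith
  have h5 : (s - p) ^ 3 * (s + 3 * p) / 6 ≤ (s - p) ^ 2 / 2 := by
    have : (s - p) ^ 3 * (s + 3 * p) ≤ (s - p) ^ 2 * 2 := by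
      have h6 : (s - p) * (s + 3 * p) ≤ 2 := by nlinarith
      calc (s - p) ^ 3 * (s + 3 * p) = (s - p) ^ 2 * ((s - p) * (s + 3 * p)) := by ring
        _ ≤ (s - p) ^ 2 * 2 := by gcongr
    nlinarith [sq_nonneg (s - p)]
  rw [← hp2, ← hs2]
  nlinarith

/-- These are tangent lines to the parabola of `sqrtGapSum_floor_ge`: the difference is exactly `(r
- 3(k + 1/2))²/6`. For `r ≤ 3` the line is nonpositive. -/
theorem sqrtGapSum_ge (r : ℝ) (k : ℕ) :
    (k : ℝ) * r - 3 / 2 * (k * (k + 1)) ≤ sqrtGapSum ⌊r⌋₊ r := by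
  rcases le_total 3 r with h | h
  · refine le_trans ?_ (sqrtGapSum_floor_ge h)
    nlinarith [sq_nonneg (r - 3 * (k + 1 / 2))]
  · refine le_trans ?_ (sqrtGapSum_nonneg _ _)
    rcases Nat.eq_zero_or_pos k with rfl | hk
    · simp
    · have : (1 : ℝ) ≤ k := by exact_mod_cast hk
      nlinarith

/-- The pointwise inequality behind the Lieb–Thirring bound, in units where the levels are the odd
numbers. -/
theorem mul_le_levels {y r : ℝ} (hr : 0 ≤ r) : ∃ N : ℕ,
    y * r ≤ r + 2 * sqrtGapSum N r + 3 * ∑ m ∈ Finset.range N, max (y - (2 * m + 1)) 0 := by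
  rcases le_total y 1 with hy | hy
  · refine ⟨0, ?_⟩
    simp only [sqrtGapSum, Finset.range_zero, Finset.sum_empty]
    nlinarith
  set k := ⌊(y - 1) / 2⌋₊ with hk
  have hk1 : (k : ℝ) ≤ (y - 1) / 2 := Nat.floor_le (by linarith)
  have hk2 : (y - 1) / 2 < k + 1 := Nat.lt_floor_add_one _
  -- Between the odd numbers `2k+1` and `2k+3` the level sum is affine in `y`. So it is enough to
  -- take the lines for `k` and `k + 1` with weights `1 - θ` and `θ`: their combination is `(k+θ)r -
  -- (3/2)(k+1)(k+2θ)`, and the level sum is `(k+1)(k+2θ)`.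
  set θ := (y - 1) / 2 - k with hθ
  have hy' : y = 2 * k + 2 * θ + 1 := by rw [hθ]; ring
  refine ⟨max ⌊r⌋₊ (k + 1), ?_⟩
  have h1 := sqrtGapSum_mono (le_max_left ⌊r⌋₊ (k + 1)) r
  have h2 : ∑ m ∈ Finset.range (k + 1), max (y - (2 * m + 1)) 0 ≤
      ∑ m ∈ Finset.range (max ⌊r⌋₊ (k + 1)), max (y - (2 * m + 1)) 0 :=
    Finset.sum_le_sum_of_subset_of_nonneg (Finset.range_mono (le_max_right _ _))
      fun _ _ _ => le_max_right _ _
  have h3 : ((k : ℝ) + 1) * (k + 2 * θ) ≤ ∑ m ∈ Finset.range (k + 1), max (y - (2 * m + 1)) 0 := by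
    have : ∀ n : ℕ, ∑ m ∈ Finset.range n, (y - (2 * m + 1)) = n * (y - n) := by
      intro n
      induction n with
      | zero => simp
      | succ n ih => rw [Finset.sum_range_succ, ih]; push_cast; ring
    calc ((k : ℝ) + 1) * (k + 2 * θ) = ∑ m ∈ Finset.range (k + 1), (y - (2 * m + 1)) := by
          rw [this, hy']; push_cast; ring
      _ ≤ _ := Finset.sum_le_sum fun _ _ => le_max_left _ _
  have h4 := sqrtGapSum_ge r k
  have h5 := sqrtGapSum_ge r (k + 1)
  push_cast at h5
  have hθ0 : 0 ≤ θ := by linarith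
  have hθ1 : 0 ≤ 1 - θ := by linarith
  have h6 := mul_le_mul_of_nonneg_left h4 hθ1
  have h7 := mul_le_mul_of_nonneg_left h5 hθ0
  rw [hy']
  rw [hy'] at h2 h3
  nlinarith

/-! ### Complex Hermite polynomials -/

/-- The complex Hermite polynomials
`H m k w = ∑ j, (-1)^j j! (m choose j) (k choose j) (conj w)^(m-j) w^(k-j)`. -/
noncomputable def complexHermite : ℕ → ℕ → ℂ → ℂ
  | 0, k, w => w ^ k
  | m + 1, k, w => conj w * complexHermite m k w - k * complexHermite m (k - 1) w

theorem complexHermite_zero (k : ℕ) (w : ℂ) : complexHermite 0 k w = w ^ k := by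
  rw [complexHermite]

theorem complexHermite_succ (m k : ℕ) (w : ℂ) : complexHermite (m + 1) k w =
    conj w * complexHermite m k w - k * complexHermite m (k - 1) w := by
  rw [complexHermite]

theorem complexHermite_right_zero (m : ℕ) (w : ℂ) : complexHermite m 0 w = conj w ^ m := by
  induction m with
  | zero => simp [complexHermite_zero]
  | succ m ih => rw [complexHermite_succ, ih]; push_cast; ring

/-- The definition recurses in the first index; this mirror recursion makes the two indices
symmetric up to conjugation. At index zero the truncated subtraction is harmless, since the
coefficient vanishes. -/
theorem complexHermite_succ_right (m k : ℕ) (w : ℂ) : complexHermite m (k + 1) w =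
    w * complexHermite m k w - m * complexHermite (m - 1) k w := by
  induction m generalizing k with
  | zero => simp [complexHermite_zero, pow_succ, mul_comm]
  | succ m ih =>
    have e1 : (m : ℂ) * complexHermite m k w = m * (conj w * complexHermite (m - 1) k w -
        k * complexHermite (m - 1) (k - 1) w) := by
      rcases m with _ | m
      · simp
      · rw [complexHermite_succ]; simp
    have e2 : (k : ℂ) * complexHermite m k w = k * (w * complexHermite m (k - 1) w -
        m * complexHermite (m - 1) (k - 1) w) := by
      rcases k with _ | k
      · simp
      · rw [ih]; simp
    rw [complexHermite_succ, complexHermite_succ m k, ih]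
    simp only [Nat.add_sub_cancel]
    push_cast
    linear_combination e1 - e2

theorem conj_complexHermite (m k : ℕ) (w : ℂ) :
    conj (complexHermite m k w) = complexHermite k m w := by
  induction m generalizing k with
  | zero => simp [complexHermite_zero, complexHermite_right_zero]
  | succ m ih => rw [complexHermite_succ, complexHermite_succ_right, ← ih, ← ih]; simp

theorem conj_mul_complexHermite (m k : ℕ) (w : ℂ) : conj w * complexHermite m k w =
    complexHermite (m + 1) k w + k * complexHermite m (k - 1) w := by
  rw [complexHermite_succ]; ring

theorem mul_complexHermite (m k : ℕ) (w : ℂ) : w * complexHermite m k w =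
    complexHermite m (k + 1) w + m * complexHermite (m - 1) k w := by
  rw [complexHermite_succ_right]; ring

theorem hasFDerivAt_complexHermite (m k : ℕ) (w : ℂ) :
    HasFDerivAt (complexHermite m k)
      ((k * complexHermite m (k - 1) w) • ContinuousLinearMap.id ℝ ℂ +
        (m * complexHermite (m - 1) k w) • (Complex.conjCLE : ℂ →L[ℝ] ℂ)) w := by
  induction m generalizing k with
  | zero =>
    have h : HasFDerivAt (fun w : ℂ => w ^ k) _ w :=
      ((hasDerivAt_pow k w).hasFDerivAt).restrictScalars ℝ
    have h' : complexHermite 0 k = fun w : ℂ => w ^ k := by ext; rw [complexHermite_zero]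
    rw [h']
    refine h.congr_fderiv ?_
    ext v
    simp [complexHermite_zero, mul_comm]
  | succ m ih =>
    have h' : complexHermite (m + 1) k = fun w => (Complex.conjCLE : ℂ →L[ℝ] ℂ) w *
        complexHermite m k w - k * complexHermite m (k - 1) w := by
      ext; rw [complexHermite_succ]; simp
    rw [h']
    have h := (((Complex.conjCLE : ℂ →L[ℝ] ℂ).hasFDerivAt (x := w)).mul (ih k)).sub
      ((ih (k - 1)).const_mul (k : ℂ))
    refine h.congr_fderiv ?_
    ext v
    · have e1 : (m : ℂ) * complexHermite m k w = m * (conj w * complexHermite (m - 1) k w -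
          k * complexHermite (m - 1) (k - 1) w) := by
        rcases m with _ | m
        · simp
        · rw [complexHermite_succ]; simp
      have e2 : (k : ℂ) * complexHermite (m + 1) (k - 1) w =
          k * (conj w * complexHermite m (k - 1) w - (k - 1 : ℕ) * complexHermite m (k - 1 - 1) w) := by
        rw [complexHermite_succ]
      simp only [sub_apply, add_apply,
        smul_apply, ContinuousLinearMap.id_apply, smul_eq_mul,
        ContinuousLinearEquiv.coe_coe, Complex.conjCLE_apply, Nat.add_sub_cancel]
      rw [e2]
      push_cast
      linear_combination (-conj v) * e1

/-- Crude, but geometric in `k` for fixed `m`, so that series over `k` with weights `1/k!` converge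
by comparison with an exponential series. -/
theorem norm_complexHermite_le (m k : ℕ) (w : ℂ) :
    ‖complexHermite m k w‖ ≤ (1 + ‖w‖) ^ m * (2 ^ m * (1 + ‖w‖)) ^ k := by
  induction m generalizing k with
  | zero =>
    rw [complexHermite_zero, norm_pow]
    simp only [pow_zero, one_mul]
    gcongr
    linarith
  | succ m ih =>
    set R := 1 + ‖w‖ with hR
    have hR1 : 1 ≤ R := by have := norm_nonneg w; linarith
    have h2 : (1 : ℝ) ≤ 2 ^ m * R := by
      have : (1 : ℝ) ≤ 2 ^ m := one_le_pow₀ (by norm_num)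
      nlinarith
    have hk : R + k ≤ R * 2 ^ k := by
      have : (k : ℝ) + 1 ≤ 2 ^ k := by exact_mod_cast Nat.lt_two_pow_self
      nlinarith
    rw [complexHermite_succ]
    calc ‖conj w * complexHermite m k w - k * complexHermite m (k - 1) w‖
        ≤ R * (R ^ m * (2 ^ m * R) ^ k) + k * (R ^ m * (2 ^ m * R) ^ k) := by
          refine (norm_sub_le _ _).trans (add_le_add ?_ ?_)
          · rw [norm_mul, RCLike.norm_conj]
            exact mul_le_mul (by linarith) (ih k) (norm_nonneg _) (by linarith)
          · rw [norm_mul, Complex.norm_natCast]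
            refine mul_le_mul_of_nonneg_left ((ih (k - 1)).trans ?_) (by positivity)
            gcongr
            omega
      _ = (R + k) * (R ^ m * (2 ^ m * R) ^ k) := by ring
      _ ≤ (R * 2 ^ k) * (R ^ m * (2 ^ m * R) ^ k) := by gcongr
      _ = R ^ (m + 1) * (2 ^ (m + 1) * R) ^ k := by 
          rw [pow_succ, pow_succ, mul_pow, mul_pow, mul_pow]; ring

theorem summable_complexHermite (m m' : ℕ) (w : ℂ) :
    Summable fun k : ℕ => complexHermite m k w * conj (complexHermite m' k w) / k.factorial := by
  set R := 1 + ‖w‖ with hR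
  refine Summable.of_norm_bounded (g := fun k : ℕ => R ^ m * R ^ m' *
    (((2 ^ m * R) * (2 ^ m' * R)) ^ k / k.factorial)) ?_ fun k => ?_
  · exact (Real.summable_pow_div_factorial _).mul_left _
  · rw [norm_div, norm_mul, RCLike.norm_conj, Complex.norm_natCast]
    calc _ ≤ (R ^ m * (2 ^ m * R) ^ k) * (R ^ m' * (2 ^ m' * R) ^ k) / k.factorial := by
          gcongr
          · exact norm_complexHermite_le m k w
          · exact norm_complexHermite_le m' k w
      _ = _ := by rw [mul_pow (2 ^ m * R)]; ring

/-- Unfold the recursion in `m`, shift `k` in the term that carries the factor `k`, and apply the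
recursion in `k` to the conjugated factor. The two multiples of `conj w` cancel. -/
theorem tsum_complexHermite_succ (m m' : ℕ) (w : ℂ) :
    ∑' k : ℕ, complexHermite (m + 1) k w * conj (complexHermite m' k w) / k.factorial =
      m' * ∑' k : ℕ, complexHermite m k w * conj (complexHermite (m' - 1) k w) / k.factorial := by
  set S := fun a b : ℕ => ∑' k : ℕ, complexHermite a k w * conj (complexHermite b k w) / k.factorial
    with hS
  have h1 : HasSum (fun k : ℕ => complexHermite m k w * conj (complexHermite m' (k + 1) w) /
      k.factorial) (conj w * S m m' - m' * S m (m' - 1)) := by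
    have := ((summable_complexHermite m m' w).hasSum.mul_left (conj w)).sub
      ((summable_complexHermite m (m' - 1) w).hasSum.mul_left (m' : ℂ))
    refine this.congr_fun ?_
    intro k
    rw [complexHermite_succ_right]
    simp only [map_sub, map_mul, map_natCast]
    ring
  have h2 : HasSum (fun k : ℕ => k * complexHermite m (k - 1) w * conj (complexHermite m' k w) /
      k.factorial) (conj w * S m m' - m' * S m (m' - 1)) := by
    rw [← hasSum_nat_add_iff' 1]
    simp only [Finset.range_one, Finset.sum_singleton, Nat.cast_zero, zero_mul, zero_div, sub_zero]
    refine h1.congr_fun ?_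
    intro k
    have : ((k : ℂ) + 1) ≠ 0 := by exact_mod_cast Nat.succ_ne_zero k
    have hf : (k.factorial : ℂ) ≠ 0 := by exact_mod_cast k.factorial_ne_zero
    rw [Nat.factorial_succ]
    simp only [Nat.add_sub_cancel]
    push_cast
    field_simp
  have h3 := ((summable_complexHermite m m' w).hasSum.mul_left (conj w)).sub h2
  have h4 : HasSum (fun k : ℕ => complexHermite (m + 1) k w * conj (complexHermite m' k w) /
      k.factorial) (m' * S m (m' - 1)) := by
    have e : m' * S m (m' - 1) = conj w * S m m' - (conj w * S m m' - m' * S m (m' - 1)) := by ring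
    rw [e]
    refine h3.congr_fun ?_
    intro k
    rw [complexHermite_succ]
    ring
  exact h4.tsum_eq

/-- The source of the constant density of a Landau level: `exp (‖w‖²)` is cancelled by the squared
Gaussian, and `m!` by the normalization. -/
theorem tsum_complexHermite_diag (m : ℕ) (w : ℂ) :
    ∑' k : ℕ, complexHermite m k w * conj (complexHermite m k w) / k.factorial =
      m.factorial * Real.exp (‖w‖ ^ 2) := by
  induction m with
  | zero =>
    have : ∀ k : ℕ, complexHermite 0 k w * conj (complexHermite 0 k w) / k.factorial =
        (((‖w‖ ^ 2) ^ k / k.factorial : ℝ) : ℂ) := by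
      intro k
      rw [complexHermite_zero, map_pow, ← mul_pow, Complex.mul_conj, Complex.normSq_eq_norm_sq]
      push_cast
      rfl
    simp_rw [this]
    rw [← Complex.ofReal_tsum, Real.exp_eq_exp_ℝ, NormedSpace.exp_eq_tsum_div]
    simp
  | succ m ih =>
    rw [tsum_complexHermite_succ, Nat.add_sub_cancel, ih, Nat.factorial_succ]
    push_cast
    ring

theorem sum_norm_complexHermite_le (m : ℕ) (K : ℕ) (w : ℂ) :
    ∑ k ∈ Finset.range K, ‖complexHermite m k w‖ ^ 2 / k.factorial ≤
      m.factorial * Real.exp (‖w‖ ^ 2) := by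
  have e : ∀ k : ℕ, complexHermite m k w * conj (complexHermite m k w) / k.factorial =
      ((‖complexHermite m k w‖ ^ 2 / k.factorial : ℝ) : ℂ) := by
    intro k
    rw [Complex.mul_conj, Complex.normSq_eq_norm_sq]
    push_cast
    rfl
  have h1 := summable_complexHermite m m w
  have h2 := tsum_complexHermite_diag m w
  simp_rw [e] at h1 h2
  rw [Complex.summable_ofReal] at h1
  rw [← Complex.ofReal_tsum] at h2
  have h3 : ∑' k : ℕ, ‖complexHermite m k w‖ ^ 2 / k.factorial =
      m.factorial * Real.exp (‖w‖ ^ 2) := by exact_mod_cast h2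
  rw [← h3]
  exact h1.sum_le_tsum _ fun k _ => by positivity

/-! ### Functions dominated by a Gaussian -/

theorem integrable_exp_neg_mul_sq_norm {a : ℝ} (ha : 0 < a) :
    Integrable fun x : Plane => Real.exp (-a * ‖x‖ ^ 2) := by
  have h := (GaussianFourier.integrable_cexp_neg_mul_sq_norm_add (V := Plane) (b := (a : ℂ))
    (by simpa using ha) 0 0).norm
  refine h.congr (Filter.Eventually.of_forall fun x => ?_)
  simp only [zero_mul, add_zero]
  rw [Complex.norm_exp]
  congr 1
  norm_cast

theorem exp_linear_sub_sq_le {a : ℝ} (ha : 0 < a) (κ t : ℝ) :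
    Real.exp (κ * t - a * t ^ 2) ≤ Real.exp (κ ^ 2 / (2 * a)) * Real.exp (-(a / 2) * t ^ 2) := by
  rw [← Real.exp_add, Real.exp_le_exp]
  have h : κ ^ 2 / (2 * a) + -(a / 2) * t ^ 2 - (κ * t - a * t ^ 2) =
      (κ - a * t) ^ 2 / (2 * a) := by
    field_simp
    ring
  have : 0 ≤ (κ - a * t) ^ 2 / (2 * a) := by positivity
  linarith

theorem integrable_of_le_exp {a C κ : ℝ} (ha : 0 < a) {E : Type*} [NormedAddCommGroup E]
    {f : Plane → E} (hf : AEStronglyMeasurable f volume)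
    (h : ∀ᵐ x, ‖f x‖ ≤ C * Real.exp (κ * ‖x‖ - a * ‖x‖ ^ 2)) : Integrable f volume := by
  refine Integrable.mono' (g := fun x => |C| * (Real.exp (κ ^ 2 / (2 * a)) *
    Real.exp (-(a / 2) * ‖x‖ ^ 2))) ?_ hf ?_
  · exact ((integrable_exp_neg_mul_sq_norm (half_pos ha)).const_mul _).const_mul _
  · filter_upwards [h] with x hx
    refine hx.trans ?_
    exact mul_le_mul (le_abs_self C) (exp_linear_sub_sq_le ha κ _) (Real.exp_pos _).le
      (abs_nonneg C)

theorem memLp_two_of_le_exp {a C κ : ℝ} (ha : 0 < a) {E : Type*} [NormedAddCommGroup E]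
    {f : Plane → E} (hf : AEStronglyMeasurable f volume)
    (h : ∀ x, ‖f x‖ ≤ C * Real.exp (κ * ‖x‖ - a * ‖x‖ ^ 2)) : MemLp f 2 volume := by
  rw [memLp_two_iff_integrable_sq_norm hf]
  refine integrable_of_le_exp (a := 2 * a) (C := C ^ 2) (κ := 2 * κ) (by positivity)
    (hf.norm.pow 2) (Filter.Eventually.of_forall fun x => ?_)
  rw [Real.norm_of_nonneg (by positivity)]
  calc ‖f x‖ ^ 2 ≤ (C * Real.exp (κ * ‖x‖ - a * ‖x‖ ^ 2)) ^ 2 := by gcongr; exact h x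
    _ = _ := by rw [mul_pow, ← Real.exp_nat_mul]; congr 2; push_cast; ring

/-! ### The Landau functions -/

/-- The complex coordinate `√(B/2) (x₁ + i x₂)`. -/
noncomputable def landauCoord (B : ℝ) : Plane →L[ℝ] ℂ :=
  (√(B / 2) : ℝ) • (Complex.ofRealCLM ∘L EuclideanSpace.proj 0 +
    Complex.I • (Complex.ofRealCLM ∘L EuclideanSpace.proj 1))

theorem landauCoord_apply (B : ℝ) (x : Plane) :
    landauCoord B x = (√(B / 2) : ℝ) * ((x 0 : ℂ) + Complex.I * (x 1 : ℂ)) := by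
  simp [landauCoord, mul_add]

theorem landauCoord_single_zero (B : ℝ) :
    landauCoord B (EuclideanSpace.single 0 1) = (√(B / 2) : ℝ) := by
  rw [landauCoord_apply]; simp

theorem landauCoord_single_one (B : ℝ) :
    landauCoord B (EuclideanSpace.single 1 1) = (√(B / 2) : ℝ) * Complex.I := by
  rw [landauCoord_apply]; simp

theorem conj_landauCoord (B : ℝ) (x : Plane) :
    conj (landauCoord B x) = (√(B / 2) : ℝ) * ((x 0 : ℂ) - Complex.I * (x 1 : ℂ)) := by
  rw [landauCoord_apply]; simp [mul_add, sub_eq_add_neg]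

theorem norm_sq_plane (x : Plane) : ‖x‖ ^ 2 = x 0 ^ 2 + x 1 ^ 2 := by
  rw [EuclideanSpace.norm_sq_eq]; simp [Fin.sum_univ_two]

theorem norm_landauCoord_sq {B : ℝ} (hB : 0 ≤ B) (x : Plane) :
    ‖landauCoord B x‖ ^ 2 = B / 2 * ‖x‖ ^ 2 := by
  rw [landauCoord_apply, norm_mul, mul_pow, norm_sq_plane, Complex.norm_real, Real.norm_eq_abs,
    sq_abs, Real.sq_sqrt (by positivity), ← Complex.normSq_eq_norm_sq, Complex.normSq_apply]
  simp only [Complex.add_re, Complex.ofReal_re, Complex.mul_re, Complex.I_re, Complex.I_im,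
    Complex.ofReal_im, Complex.add_im, Complex.mul_im]
  ring

/-- The unnormalized Landau functions: complex Hermite polynomials times a Gaussian. -/
noncomputable def landauFun (B : ℝ) (m k : ℕ) (x : Plane) : ℂ :=
  complexHermite m k (landauCoord B x) * (Real.exp (-(B / 4) * ‖x‖ ^ 2) : ℝ)

theorem contDiff_complexHermite (m k : ℕ) : ContDiff ℝ ∞ (complexHermite m k) := by
  induction m generalizing k with
  | zero =>
    have : complexHermite 0 k = fun w => w ^ k := by ext; rw [complexHermite_zero]
    rw [this]; fun_prop
  | succ m ih =>
    have : complexHermite (m + 1) k = fun w => (Complex.conjCLE : ℂ →L[ℝ] ℂ) w *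
        complexHermite m k w - k * complexHermite m (k - 1) w := by
      ext; rw [complexHermite_succ]; simp
    rw [this]
    have h1 := ih k
    have h2 := ih (k - 1)
    fun_prop

theorem contDiff_landauFun (B : ℝ) (m k : ℕ) : ContDiff ℝ ∞ (landauFun B m k) := by
  have h := contDiff_complexHermite m k
  have h2 : ContDiff ℝ ∞ fun x : Plane => ‖x‖ ^ 2 := contDiff_norm_sq ℝ
  have h3 : ContDiff ℝ ∞ fun x : Plane => (Real.exp (-(B / 4) * ‖x‖ ^ 2) : ℂ) := by
    exact Complex.ofRealCLM.contDiff.comp (Real.contDiff_exp.comp (contDiff_const.mul h2))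
  exact (h.comp (landauCoord B).contDiff).mul h3

theorem hasFDerivAt_gaussian (B : ℝ) (x : Plane) (j : Fin 2) :
    ∃ L : Plane →L[ℝ] ℂ,
      HasFDerivAt (fun x : Plane => (Real.exp (-(B / 4) * ‖x‖ ^ 2) : ℂ)) L x ∧
      L (EuclideanSpace.single j 1) =
        -(B / 2 * x j : ℝ) * (Real.exp (-(B / 4) * ‖x‖ ^ 2) : ℝ) := by
  have h1 : HasFDerivAt (fun x : Plane => ‖x‖ ^ 2) (2 • innerSL ℝ x) x :=
    (hasStrictFDerivAt_norm_sq x).hasFDerivAt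
  have h2 := (Complex.ofRealCLM.hasFDerivAt (x := Real.exp (-(B / 4) * ‖x‖ ^ 2))).comp x
    ((h1.const_mul (-(B / 4))).exp)
  refine ⟨_, h2, ?_⟩
  simp only [ContinuousLinearMap.comp_apply, smul_apply, innerSL_apply_apply,
    Complex.ofRealCLM_apply, EuclideanSpace.inner_single_right]
  simp
  ring

theorem fderiv_landauFun (B : ℝ) (m k : ℕ) (x : Plane) (j : Fin 2) :
    fderiv ℝ (landauFun B m k) x (EuclideanSpace.single j 1) =
      (k * complexHermite m (k - 1) (landauCoord B x) *
          landauCoord B (EuclideanSpace.single j 1) +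
        m * complexHermite (m - 1) k (landauCoord B x) *
          conj (landauCoord B (EuclideanSpace.single j 1)) -
        (B / 2 * x j : ℝ) * complexHermite m k (landauCoord B x)) *
      (Real.exp (-(B / 4) * ‖x‖ ^ 2) : ℝ) := by
  obtain ⟨L, hL, hLj⟩ := hasFDerivAt_gaussian B x j
  have h1 := (hasFDerivAt_complexHermite m k (landauCoord B x)).comp x
    ((landauCoord B).hasFDerivAt (x := x))
  have h2 : HasFDerivAt (landauFun B m k) _ x := h1.mul hL
  rw [h2.fderiv]
  simp only [add_apply, smul_apply, hLj, ContinuousLinearMap.comp_apply, smul_eq_mul,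
    ContinuousLinearMap.id_apply, ContinuousLinearEquiv.coe_coe, Complex.conjCLE_apply,
    Function.comp_apply]
  ring

/-- In the first index the magnetic derivatives are combinations of a raising and a lowering
operator. The second index is untouched: it labels the infinite degeneracy of a level. -/
theorem magDeriv_zero_landauFun {B : ℝ} (hB : 0 ≤ B) (m k : ℕ) (x : Plane) :
    magDeriv B 0 (landauFun B m k) x = Complex.I * (√(B / 2) : ℝ) *
      (landauFun B (m + 1) k x - m * landauFun B (m - 1) k x) := by
  have hs : ((√(B / 2) : ℝ) : ℂ) ^ 2 = (B : ℂ) / 2 := by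
    rw [← Complex.ofReal_pow, Real.sq_sqrt (by positivity)]; push_cast; rfl
  have hA : landauPotential B x 0 = B * x 1 / 2 := rfl
  rw [magDeriv, fderiv_landauFun, landauCoord_single_zero, hA, Complex.conj_ofReal]
  simp only [landauFun, complexHermite_succ, conj_landauCoord]
  generalize ((Real.exp (-(B / 4) * ‖x‖ ^ 2) : ℝ) : ℂ) = g
  generalize complexHermite m k (landauCoord B x) = h
  generalize ((√(B / 2) : ℝ) : ℂ) = s at *
  push_cast
  linear_combination (h * g) * ((Complex.I ^ 2 * x 1 - Complex.I * x 0) * hs +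
    (B / 2 * x 1) * Complex.I_sq)

theorem magDeriv_one_landauFun {B : ℝ} (hB : 0 ≤ B) (m k : ℕ) (x : Plane) :
    magDeriv B 1 (landauFun B m k) x = -(√(B / 2) : ℝ) *
      (landauFun B (m + 1) k x + m * landauFun B (m - 1) k x) := by
  have hs : ((√(B / 2) : ℝ) : ℂ) ^ 2 = (B : ℂ) / 2 := by
    rw [← Complex.ofReal_pow, Real.sq_sqrt (by positivity)]; push_cast; rfl
  have hA : landauPotential B x 1 = -(B * x 0 / 2) := rfl
  rw [magDeriv, fderiv_landauFun, landauCoord_single_one, hA, map_mul, Complex.conj_ofReal,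
    Complex.conj_I]
  simp only [landauFun, complexHermite_succ, conj_landauCoord]
  generalize ((Real.exp (-(B / 4) * ‖x‖ ^ 2) : ℝ) : ℂ) = g
  generalize complexHermite m k (landauCoord B x) = h
  generalize complexHermite m (k - 1) (landauCoord B x) = h1
  generalize complexHermite (m - 1) k (landauCoord B x) = h2
  generalize ((√(B / 2) : ℝ) : ℂ) = s at *
  push_cast
  linear_combination (h * g) * (x 0 - Complex.I * x 1) * hs +
    (-k * h1 + m * h2) * s * g * Complex.I_sq

theorem norm_landauFun_le {B : ℝ} (hB : 0 ≤ B) (m k : ℕ) : ∃ C κ : ℝ, 0 ≤ C ∧ ∀ x,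
    ‖landauFun B m k x‖ ≤ C * Real.exp (κ * ‖x‖ - B / 4 * ‖x‖ ^ 2) := by
  set s := √(B / 2)
  have hs : 0 ≤ s := Real.sqrt_nonneg _
  refine ⟨(2 ^ m) ^ k * ((m + k).factorial * Real.exp 1), s, by positivity, fun x => ?_⟩
  have hn : ‖landauCoord B x‖ = s * ‖x‖ := by
    rw [← sq_eq_sq₀ (norm_nonneg _) (by positivity), norm_landauCoord_sq hB, mul_pow,
      Real.sq_sqrt (by positivity)]
  rw [landauFun, norm_mul, Complex.norm_real, Real.norm_of_nonneg (Real.exp_pos _).le]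
  have h1 := norm_complexHermite_le m k (landauCoord B x)
  rw [hn] at h1
  have h2 : (1 + s * ‖x‖) ^ (m + k) ≤ (m + k).factorial * Real.exp (1 + s * ‖x‖) := by
    have := Real.pow_div_factorial_le_exp (1 + s * ‖x‖) (by positivity) (m + k)
    rwa [div_le_iff₀' (by positivity)] at this
  calc _ ≤ ((1 + s * ‖x‖) ^ m * (2 ^ m * (1 + s * ‖x‖)) ^ k) * Real.exp (-(B / 4) * ‖x‖ ^ 2) := by
        gcongr
    _ = (2 ^ m) ^ k * (1 + s * ‖x‖) ^ (m + k) * Real.exp (-(B / 4) * ‖x‖ ^ 2) := by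
        rw [mul_pow, pow_add]; ring
    _ ≤ (2 ^ m) ^ k * ((m + k).factorial * Real.exp (1 + s * ‖x‖)) *
          Real.exp (-(B / 4) * ‖x‖ ^ 2) := by gcongr
    _ = _ := by
        rw [Real.exp_add, sub_eq_add_neg, Real.exp_add, neg_mul]; ring

theorem continuous_landauFun (B : ℝ) (m k : ℕ) : Continuous (landauFun B m k) :=
  (contDiff_landauFun B m k).continuous

theorem memLp_landauFun {B : ℝ} (hB : 0 < B) (m k : ℕ) : MemLp (landauFun B m k) 2 volume := by
  obtain ⟨C, κ, -, h⟩ := norm_landauFun_le hB.le m k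
  exact memLp_two_of_le_exp (by positivity) (continuous_landauFun B m k).aestronglyMeasurable h

theorem memLp_magDeriv_landauFun {B : ℝ} (hB : 0 < B) (j : Fin 2) (m k : ℕ) :
    MemLp (magDeriv B j (landauFun B m k)) 2 volume := by
  fin_cases j
  · have : magDeriv B 0 (landauFun B m k) = fun x => (Complex.I * (√(B / 2) : ℝ)) *
        (landauFun B (m + 1) k x - m * landauFun B (m - 1) k x) := by
      ext x; rw [magDeriv_zero_landauFun hB.le]
    exact this ▸ ((memLp_landauFun hB _ _).sub ((memLp_landauFun hB _ _).const_mul _)).const_mul _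
  · have : magDeriv B 1 (landauFun B m k) = fun x => (-(√(B / 2) : ℝ) : ℂ) *
        (landauFun B (m + 1) k x + m * landauFun B (m - 1) k x) := by
      ext x; rw [magDeriv_one_landauFun hB.le]
    exact this ▸ ((memLp_landauFun hB _ _).add ((memLp_landauFun hB _ _).const_mul _)).const_mul _

theorem integrable_conj_mul {f g : Plane → ℂ} (hf : MemLp f 2 volume) (hg : MemLp g 2 volume) :
    Integrable (fun x => conj (f x) * g x) volume := by
  have hf' : MemLp (fun x => conj (f x)) 2 volume := hf.star
  exact hf'.integrable_mul hg

/-! ### Testing weak derivatives against square integrable functions -/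

theorem magDeriv_ofReal_mul {B : ℝ} {j : Fin 2} {χ : Plane → ℝ} {φ : Plane → ℂ} {x : Plane}
    (hχ : DifferentiableAt ℝ χ x) (hφ : DifferentiableAt ℝ φ x) :
    magDeriv B j (fun y => (χ y : ℂ) * φ y) x = χ x * magDeriv B j φ x -
      Complex.I * (fderiv ℝ χ x (EuclideanSpace.single j 1) : ℝ) * φ x := by
  have h1 : HasFDerivAt (fun y => (χ y : ℂ)) (Complex.ofRealCLM ∘L fderiv ℝ χ x) x :=
    Complex.ofRealCLM.hasFDerivAt.comp x hχ.hasFDerivAt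
  have h2 : HasFDerivAt (fun y => (χ y : ℂ) * φ y) _ x := h1.mul hφ.hasFDerivAt
  rw [magDeriv, h2.fderiv, magDeriv]
  simp only [add_apply, smul_apply, ContinuousLinearMap.comp_apply, Complex.ofRealCLM_apply,
    smul_eq_mul]
  ring

theorem continuous_magDeriv (B : ℝ) (j : Fin 2) {φ : Plane → ℂ} (hφ : ContDiff ℝ ∞ φ) :
    Continuous (magDeriv B j φ) := by
  have h1 : Continuous fun x => fderiv ℝ φ x (EuclideanSpace.single j 1) :=
    (hφ.continuous_fderiv (by simp)).clm_apply continuous_const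
  have h2 : Continuous fun x => landauPotential B x j := by
    fin_cases j
    · change Continuous fun x : Plane => B * x 1 / 2
      fun_prop
    · change Continuous fun x : Plane => -(B * x 0 / 2)
      fun_prop
  unfold magDeriv
  have := hφ.continuous
  fun_prop

theorem integral_conj_magDeriv_of_hasCompactSupport (B : ℝ) (j : Fin 2) {φ ψ : Plane → ℂ}
    (hφ : ContDiff ℝ ∞ φ) (hψ : ContDiff ℝ ∞ ψ) (hc : HasCompactSupport φ) :
    ∫ x, conj (magDeriv B j φ x) * ψ x = ∫ x, conj (φ x) * magDeriv B j ψ x := by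
  set v : Plane := EuclideanSpace.single j 1
  set f : Plane → ℂ := fun x => conj (φ x) with hf
  have hfc : HasCompactSupport f := hc.comp_left (g := fun z : ℂ => conj z) (by simp)
  have hfd : ContDiff ℝ ∞ f := Complex.conjCLE.contDiff.comp hφ
  have hfderiv : ∀ x, fderiv ℝ f x v = conj (fderiv ℝ φ x v) := by
    intro x
    have : HasFDerivAt f ((Complex.conjCLE : ℂ →L[ℝ] ℂ) ∘L fderiv ℝ φ x) x :=
      (Complex.conjCLE : ℂ →L[ℝ] ℂ).hasFDerivAt.comp x (hφ.differentiable (by simp) x).hasFDerivAt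
    rw [this.fderiv]
    simp
  have c1 : Continuous fun x => fderiv ℝ f x v :=
    (hfd.continuous_fderiv (by simp)).clm_apply continuous_const
  have c2 : Continuous fun x => fderiv ℝ ψ x v :=
    (hψ.continuous_fderiv (by simp)).clm_apply continuous_const
  have s1 : HasCompactSupport fun x => fderiv ℝ f x v := hfc.fderiv_apply (𝕜 := ℝ) v
  have i1 : Integrable (fun x => fderiv ℝ f x v * ψ x) volume :=
    (c1.mul hψ.continuous).integrable_of_hasCompactSupport s1.mul_right
  have i2 : Integrable (fun x => f x * fderiv ℝ ψ x v) volume :=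
    (hfd.continuous.mul c2).integrable_of_hasCompactSupport hfc.mul_right
  have i3 : Integrable (fun x => f x * ψ x) volume :=
    (hfd.continuous.mul hψ.continuous).integrable_of_hasCompactSupport hfc.mul_right
  have key := integral_mul_fderiv_eq_neg_fderiv_mul_of_integrable i1 i2 i3
    (fun x _ => hfd.differentiable (by simp) x) (fun x _ => hψ.differentiable (by simp) x)
  have i4 : Integrable (fun x => conj (magDeriv B j φ x) * ψ x) volume := by
    refine Continuous.integrable_of_hasCompactSupport ?_ ?_
    · have := continuous_magDeriv B j hφ
      have := hψ.continuous
      fun_prop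
    · refine HasCompactSupport.mul_right ?_
      refine HasCompactSupport.comp_left (g := fun z : ℂ => conj z) ?_ (by simp)
      exact ((hc.fderiv_apply (𝕜 := ℝ) v).mul_left).add hc.mul_left
  have i5 : Integrable (fun x => conj (φ x) * magDeriv B j ψ x) volume :=
    (hfd.continuous.mul (continuous_magDeriv B j hψ)).integrable_of_hasCompactSupport hfc.mul_right
  have e1 : ∀ x, conj (magDeriv B j φ x) * ψ x - conj (φ x) * magDeriv B j ψ x =
      Complex.I * (fderiv ℝ f x v * ψ x) + Complex.I * (f x * fderiv ℝ ψ x v) := by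
    intro x
    rw [hfderiv]
    simp only [magDeriv, map_add, map_mul, map_neg, Complex.conj_I, Complex.conj_ofReal, hf, v]
    ring
  rw [← sub_eq_zero, ← integral_sub i4 i5]
  simp_rw [e1]
  rw [integral_add (i1.const_mul _) (i2.const_mul _), integral_const_mul, integral_const_mul, key]
  ring

/-- If `g` is the weak magnetic derivative of `u`, both square integrable, then compact support
of the test functions may be replaced by square integrability. -/
theorem integral_conj_magDeriv_of_memLp {B : ℝ} {j : Fin 2} {u g φ : Plane → ℂ}
    (hu : MemLp u 2 volume) (hg : MemLp g 2 volume)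
    (h : ∀ φ : Plane → ℂ, ContDiff ℝ ∞ φ → HasCompactSupport φ →
      ∫ x, conj (magDeriv B j φ x) * u x = ∫ x, conj (φ x) * g x)
    (hφ : ContDiff ℝ ∞ φ) (hφ2 : MemLp φ 2 volume) (hDφ : MemLp (magDeriv B j φ) 2 volume) :
    ∫ x, conj (magDeriv B j φ x) * u x = ∫ x, conj (φ x) * g x := by
  let f : ContDiffBump (0 : Plane) := ⟨1, 2, one_pos, one_lt_two⟩
  have hf : ContDiff ℝ ∞ (f : Plane → ℝ) := f.contDiff
  obtain ⟨C, hC⟩ : ∃ C, ∀ x, ‖fderiv ℝ f x‖ ≤ C :=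
    (hf.continuous_fderiv (by simp)).bounded_above_of_compact_support
      (f.hasCompactSupport.fderiv (𝕜 := ℝ))
  have hC0 : 0 ≤ C := (norm_nonneg _).trans (hC 0)
  let c : ℕ → ℝ := fun n => ((n : ℝ) + 1)⁻¹
  have hc0 : ∀ n, 0 < c n := fun n => by positivity
  have hc1 : ∀ n, c n ≤ 1 := fun n => inv_le_one_of_one_le₀ (by simp)
  -- Dilated cutoffs. Their gradients are uniformly bounded and at each point eventually vanish, so
  -- the commutator term disappears in the limit by dominated convergence.
  let χ : ℕ → Plane → ℝ := fun n x => f (c n • x)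
  have hχ : ∀ n, ContDiff ℝ ∞ (χ n) := fun n => hf.comp (contDiff_const_smul (c n))
  have hχd : ∀ n x, fderiv ℝ (χ n) x = c n • fderiv ℝ f (c n • x) := by
    intro n x
    have h1 : HasFDerivAt (fun x : Plane => c n • x) (c n • ContinuousLinearMap.id ℝ Plane) x :=
      (hasFDerivAt_id x).const_smul (c n)
    have h2 := (hf.differentiable (by simp) (c n • x)).hasFDerivAt.comp x h1
    rw [show χ n = f ∘ fun x : Plane => c n • x from rfl, h2.fderiv]
    ext y
    simp
  have hev : ∀ x : Plane, ∀ᶠ n in Filter.atTop, c n • x ∈ Metric.ball (0 : Plane) 1 := by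
    intro x
    obtain ⟨N, hN⟩ := exists_nat_gt ‖x‖
    filter_upwards [Filter.eventually_ge_atTop N] with n hn
    have hn' : (N : ℝ) ≤ n := by exact_mod_cast hn
    rw [mem_ball_zero_iff, norm_smul, Real.norm_of_nonneg (hc0 n).le]
    calc c n * ‖x‖ < c n * (n + 1) := by
          have := hc0 n
          gcongr
          linarith
      _ = 1 := by simp only [c]; field_simp
  have hval : ∀ n x, conj (magDeriv B j (fun y => (χ n y : ℂ) * φ y) x) * u x =
      χ n x * (conj (magDeriv B j φ x) * u x) + Complex.I *
        (fderiv ℝ (χ n) x (EuclideanSpace.single j 1) : ℝ) * (conj (φ x) * u x) := by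
    intro n x
    rw [magDeriv_ofReal_mul ((hχ n).differentiable (by simp) x) (hφ.differentiable (by simp) x)]
    simp only [map_sub, map_mul, Complex.conj_I, Complex.conj_ofReal]
    ring
  have heq : ∀ n, ∫ x, conj (magDeriv B j (fun y => (χ n y : ℂ) * φ y) x) * u x =
      ∫ x, (χ n x : ℂ) * (conj (φ x) * g x) := by
    intro n
    rw [h (fun y => (χ n y : ℂ) * φ y) ((Complex.ofRealCLM.contDiff.comp (hχ n)).mul hφ)]
    · refine integral_congr_ae (Filter.Eventually.of_forall fun x => ?_)
      simp only [map_mul, Complex.conj_ofReal]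
      ring
    · refine HasCompactSupport.mul_right (f := fun y => (χ n y : ℂ)) ?_
      refine HasCompactSupport.comp_left (g := fun t : ℝ => (t : ℂ)) ?_ (by simp)
      exact f.hasCompactSupport.comp_homeomorph (Homeomorph.smulOfNeZero (c n) (hc0 n).ne')
  have iA := integrable_conj_mul hDφ hu
  have iB := integrable_conj_mul hφ2 hu
  have iC := integrable_conj_mul hφ2 hg
  have hχle : ∀ n x, ‖(χ n x : ℂ)‖ ≤ 1 := by
    intro n x
    rw [Complex.norm_real, Real.norm_of_nonneg f.nonneg]
    exact f.le_one
  have hdle : ∀ n x, ‖((fderiv ℝ (χ n) x (EuclideanSpace.single j 1) : ℝ) : ℂ)‖ ≤ C := by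
    intro n x
    rw [Complex.norm_real, hχd, smul_apply, norm_smul,
      Real.norm_of_nonneg (hc0 n).le]
    have h1 := (fderiv ℝ f (c n • x)).le_opNorm (EuclideanSpace.single j 1)
    have h2 : ‖(EuclideanSpace.single j 1 : Plane)‖ = 1 := by simp
    rw [h2, mul_one] at h1
    calc _ ≤ 1 * C := mul_le_mul (hc1 n) (h1.trans (hC _)) (norm_nonneg _) zero_le_one
      _ = C := one_mul C
  have cχ : ∀ n, Continuous (χ n) := fun n => (hχ n).continuous
  have cd : ∀ n, Continuous fun x => fderiv ℝ (χ n) x (EuclideanSpace.single j 1) := fun n =>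
    ((hχ n).continuous_fderiv (by simp)).clm_apply continuous_const
  have t1 : Filter.Tendsto (fun n => ∫ x, (χ n x * (conj (magDeriv B j φ x) * u x) + Complex.I *
        (fderiv ℝ (χ n) x (EuclideanSpace.single j 1) : ℝ) * (conj (φ x) * u x)))
      Filter.atTop (nhds (∫ x, conj (magDeriv B j φ x) * u x)) := by
    refine tendsto_integral_of_dominated_convergence
      (fun x => ‖conj (magDeriv B j φ x) * u x‖ + C * ‖conj (φ x) * u x‖) ?_
      (iA.norm.add (iB.norm.const_mul C)) ?_ ?_
    · intro n
      have h1 : AEStronglyMeasurable (fun x => (χ n x : ℂ)) volume :=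
        (Complex.continuous_ofReal.comp (cχ n)).aestronglyMeasurable
      have h2 : AEStronglyMeasurable (fun x => Complex.I *
          (fderiv ℝ (χ n) x (EuclideanSpace.single j 1) : ℝ)) volume :=
        (continuous_const.mul (Complex.continuous_ofReal.comp (cd n))).aestronglyMeasurable
      exact (h1.mul iA.1).add (h2.mul iB.1)
    · intro n
      refine Filter.Eventually.of_forall fun x => (norm_add_le _ _).trans (add_le_add ?_ ?_)
      · rw [norm_mul]
        exact mul_le_of_le_one_left (norm_nonneg _) (hχle n x)
      · rw [norm_mul, norm_mul, Complex.norm_I, one_mul]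
        exact mul_le_mul_of_nonneg_right (hdle n x) (norm_nonneg _)
    · refine Filter.Eventually.of_forall fun x => ?_
      refine tendsto_const_nhds.congr' ?_
      filter_upwards [hev x] with n hn
      have e1 : χ n x = 1 := f.one_of_mem_closedBall (Metric.ball_subset_closedBall hn)
      have e2 : fderiv ℝ f (c n • x) = 0 := by
        rw [(f.eventuallyEq_one_of_mem_ball hn).fderiv_eq]
        exact fderiv_const_apply (1 : ℝ)
      rw [hχd, e1, e2]
      simp
  have t2 : Filter.Tendsto (fun n => ∫ x, (χ n x : ℂ) * (conj (φ x) * g x)) Filter.atTop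
      (nhds (∫ x, conj (φ x) * g x)) := by
    refine tendsto_integral_of_dominated_convergence (fun x => ‖conj (φ x) * g x‖) ?_ iC.norm ?_ ?_
    · exact fun n => (Complex.continuous_ofReal.comp (cχ n)).aestronglyMeasurable.mul iC.1
    · intro n
      refine Filter.Eventually.of_forall fun x => ?_
      rw [norm_mul]
      exact mul_le_of_le_one_left (norm_nonneg _) (hχle n x)
    · refine Filter.Eventually.of_forall fun x => ?_
      refine tendsto_const_nhds.congr' ?_
      filter_upwards [hev x] with n hn
      have e1 : χ n x = 1 := f.one_of_mem_closedBall (Metric.ball_subset_closedBall hn)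
      rw [e1]
      simp
  refine tendsto_nhds_unique t1 (t2.congr fun n => ?_)
  rw [← heq]
  simp_rw [hval]

/-- Symmetry of the magnetic derivatives on smooth square integrable functions. -/
theorem integral_conj_magDeriv_symm {B : ℝ} {j : Fin 2} {φ ψ : Plane → ℂ}
    (hφ : ContDiff ℝ ∞ φ) (hφ2 : MemLp φ 2 volume) (hDφ : MemLp (magDeriv B j φ) 2 volume)
    (hψ : ContDiff ℝ ∞ ψ) (hψ2 : MemLp ψ 2 volume) (hDψ : MemLp (magDeriv B j ψ) 2 volume) :
    ∫ x, conj (magDeriv B j φ x) * ψ x = ∫ x, conj (φ x) * magDeriv B j ψ x :=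
  integral_conj_magDeriv_of_memLp hψ2 hDψ
    (fun _ h1 h2 => integral_conj_magDeriv_of_hasCompactSupport B j h1 hψ h2) hφ hφ2 hDφ

/-! ### Orthogonality of the Landau functions -/

theorem conj_landauFun (B : ℝ) (m k : ℕ) (x : Plane) :
    conj (landauFun B m k x) = landauFun B k m x := by
  rw [landauFun, map_mul, conj_complexHermite, Complex.conj_ofReal, landauFun]

/-- The raising operator is adjoint to the lowering operator. Symmetry of the two magnetic
derivatives gives one relation with a difference and one with a sum of ladder terms; combining them
isolates a single term on each side. -/
theorem integral_landauFun_succ {B : ℝ} (hB : 0 < B) (m k m' k' : ℕ) :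
    ∫ x, conj (landauFun B (m + 1) k x) * landauFun B m' k' x =
      m' * ∫ x, conj (landauFun B m k x) * landauFun B (m' - 1) k' x := by
  have hs : ((√(B / 2) : ℝ) : ℂ) ≠ 0 := by
    exact_mod_cast (Real.sqrt_pos.2 (half_pos hB)).ne'
  set J := fun a b : ℕ => ∫ x, conj (landauFun B a k x) * landauFun B b k' x with hJ
  have hI : ∀ a b, Integrable (fun x => conj (landauFun B a k x) * landauFun B b k' x) volume :=
    fun a b => integrable_conj_mul (memLp_landauFun hB a k) (memLp_landauFun hB b k')
  have h := fun j => integral_conj_magDeriv_symm (B := B) (j := j) (contDiff_landauFun B m k)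
    (memLp_landauFun hB m k) (memLp_magDeriv_landauFun hB j m k) (contDiff_landauFun B m' k')
    (memLp_landauFun hB m' k') (memLp_magDeriv_landauFun hB j m' k')
  have h0 := h 0
  have h1 := h 1
  simp_rw [magDeriv_zero_landauFun hB.le] at h0
  simp_rw [magDeriv_one_landauFun hB.le] at h1
  have e0 : ∫ x, conj (Complex.I * (√(B / 2) : ℝ) * (landauFun B (m + 1) k x -
      m * landauFun B (m - 1) k x)) * landauFun B m' k' x =
      -(Complex.I * (√(B / 2) : ℝ)) * (J (m + 1) m' - m * J (m - 1) m') := by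
    rw [hJ, ← integral_const_mul, ← integral_sub (hI _ _) ((hI _ _).const_mul _),
      ← integral_const_mul]
    congr 1
    ext x
    simp only [map_mul, map_sub, Complex.conj_I, Complex.conj_ofReal, map_natCast]
    ring
  have e0' : ∫ x, conj (landauFun B m k x) * (Complex.I * (√(B / 2) : ℝ) *
      (landauFun B (m' + 1) k' x - m' * landauFun B (m' - 1) k' x)) =
      Complex.I * (√(B / 2) : ℝ) * (J m (m' + 1) - m' * J m (m' - 1)) := by
    rw [hJ, ← integral_const_mul, ← integral_sub (hI _ _) ((hI _ _).const_mul _),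
      ← integral_const_mul]
    congr 1
    ext x
    ring
  have e1 : ∫ x, conj (-(√(B / 2) : ℝ) * (landauFun B (m + 1) k x +
      m * landauFun B (m - 1) k x)) * landauFun B m' k' x =
      -(√(B / 2) : ℝ) * (J (m + 1) m' + m * J (m - 1) m') := by
    rw [hJ, ← integral_const_mul, ← integral_add (hI _ _) ((hI _ _).const_mul _),
      ← integral_const_mul]
    congr 1
    ext x
    simp only [map_mul, map_add, map_neg, Complex.conj_ofReal, map_natCast]
    ring
  have e1' : ∫ x, conj (landauFun B m k x) * (-(√(B / 2) : ℝ) *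
      (landauFun B (m' + 1) k' x + m' * landauFun B (m' - 1) k' x)) =
      -(√(B / 2) : ℝ) * (J m (m' + 1) + m' * J m (m' - 1)) := by
    rw [hJ, ← integral_const_mul, ← integral_add (hI _ _) ((hI _ _).const_mul _),
      ← integral_const_mul]
    congr 1
    ext x
    ring
  rw [e0, e0', neg_mul, ← mul_neg] at h0
  rw [e1, e1'] at h1
  have h0' := mul_left_cancel₀ (mul_ne_zero Complex.I_ne_zero hs) h0
  have h1' := mul_left_cancel₀ (neg_ne_zero.2 hs) h1
  change J (m + 1) m' = m' * J m (m' - 1)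
  linear_combination (1 / 2 : ℂ) * (h1' - h0')

theorem integral_landauFun_zero_zero {B : ℝ} (hB : 0 < B) :
    ∫ x, conj (landauFun B 0 0 x) * landauFun B 0 0 x = ((2 * Real.pi / B : ℝ) : ℂ) := by
  have h := GaussianFourier.integral_rexp_neg_mul_sq_norm (V := Plane) (half_pos hB)
  rw [finrank_euclideanSpace_fin] at h
  have e : ∀ x : Plane, conj (landauFun B 0 0 x) * landauFun B 0 0 x =
      ((Real.exp (-(B / 2) * ‖x‖ ^ 2) : ℝ) : ℂ) := by
    intro x
    rw [conj_landauFun, landauFun, complexHermite_zero, pow_zero, one_mul, ← Complex.ofReal_mul,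
      ← Real.exp_add]
    congr 2
    ring
  simp_rw [e]
  rw [integral_complex_ofReal, h]
  congr 1
  norm_num
  field_simp

theorem integral_landauFun {B : ℝ} (hB : 0 < B) (m k m' k' : ℕ) :
    ∫ x, conj (landauFun B m k x) * landauFun B m' k' x =
      if m = m' ∧ k = k' then ((2 * Real.pi / B * (m.factorial * k.factorial) : ℝ) : ℂ) else 0 := by
  have hz : ∀ m k k', ∫ x, conj (landauFun B (m + 1) k x) * landauFun B 0 k' x = 0 := by
    intro m k k'
    rw [integral_landauFun_succ hB]
    simp
  have hz' : ∀ m k k', ∫ x, conj (landauFun B 0 k x) * landauFun B (m + 1) k' x = 0 := by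
    intro m k k'
    have : ∀ x, conj (landauFun B 0 k x) * landauFun B (m + 1) k' x =
        conj (conj (landauFun B (m + 1) k' x) * landauFun B 0 k x) := by
      intro x
      simp [mul_comm]
    simp_rw [this, integral_conj, hz, map_zero]
  -- Conjugation exchanges the two indices, so once the first index has been lowered to zero, the
  -- same recursion lowers the second.
  have hsymm : ∀ m k m' k', ∫ x, conj (landauFun B m k x) * landauFun B m' k' x =
      ∫ x, conj (landauFun B k' m' x) * landauFun B k m x := by
    intro m k m' k'
    congr 1
    ext x
    rw [conj_landauFun, conj_landauFun, mul_comm]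
  induction m generalizing m' k k' with
  | zero =>
    rcases m' with _ | m'
    · rw [hsymm]
      induction k generalizing k' with
      | zero =>
        rcases k' with _ | k'
        · simpa using integral_landauFun_zero_zero hB
        · rw [hz]; simp
      | succ k ih =>
        rcases k' with _ | k'
        · rw [hz']; simp
        · rw [integral_landauFun_succ hB, Nat.add_sub_cancel, ih]
          by_cases h : k = k'
          · subst h
            simp only [and_self, if_true, Nat.factorial_succ]
            push_cast
            ring
          · simp [h]
    · rw [hz']; simp
  | succ m ih =>
    rcases m' with _ | m'
    · rw [hz]; simp
    · rw [integral_landauFun_succ hB, Nat.add_sub_cancel, ih]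
      by_cases h : m = m' ∧ k = k'
      · obtain ⟨rfl, rfl⟩ := h
        simp only [and_self, if_true, Nat.factorial_succ]
        push_cast
        ring
      · rw [if_neg h, if_neg (by simpa using h), mul_zero]

/-! ### Completeness of the Landau functions -/

theorem inner_eq_integral (u v : L2Plane) : inner ℂ u v = ∫ x, conj (u x) * v x := by
  rw [L2.inner_def]
  simp_rw [RCLike.inner_apply, mul_comm]

open scoped FourierTransform in
-- A smooth compactly supported `g` is the Fourier transform of a Schwartz function `T`. Moving the
-- transform from `T` to `f` shows that `∫ g f = 0`.
theorem ae_eq_zero_of_fourier_eq_zero {f : Plane → ℂ} (hf : Integrable f volume)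
    (h : ∀ ξ, 𝓕 f ξ = 0) : ∀ᵐ x, f x = 0 := by
  refine ae_eq_zero_of_integral_contDiff_smul_eq_zero hf.locallyIntegrable fun g hg hgc => ?_
  have hg₁ : HasCompactSupport (Complex.ofRealCLM ∘ g) := hgc.comp_left rfl
  have hg₂ : ContDiff ℝ ∞ (Complex.ofRealCLM ∘ g) := by fun_prop
  set S := hg₁.toSchwartzMap hg₂ with hS
  set T : SchwartzMap Plane ℂ := 𝓕⁻ S with hT
  have h1 : 𝓕 T = S := FourierTransform.fourier_fourierInv_eq S
  have h2 := VectorFourier.integral_fourierIntegral_smul_eq_flip (L := innerₗ Plane)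
    Real.continuous_fourierChar continuous_inner T.integrable hf
    (μ := volume) (ν := volume)
  have h3 : ∀ x, VectorFourier.fourierIntegral Real.fourierChar volume (innerₗ Plane)
      T x = (g x : ℂ) := by
    intro x
    calc _ = 𝓕 T x := by rw [SchwartzMap.fourier_coe]; rfl
      _ = S x := by rw [h1]
      _ = g x := rfl
  have h4 : ∀ x,
      VectorFourier.fourierIntegral Real.fourierChar volume (innerₗ Plane).flip f x = 0 := by
    intro x
    rw [← h x]
    simp
    rfl
  simp_rw [h3, h4, smul_zero, integral_zero] at h2
  simpa using h2

theorem exists_inner_eq_landauCoord {B : ℝ} (hB : 0 < B) (ξ : Plane) : ∃ s t : ℂ, ∀ x : Plane,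
    ((inner ℝ x ξ : ℝ) : ℂ) = s * conj (landauCoord B x) + t * landauCoord B x := by
  have hs : ((√(B / 2) : ℝ) : ℂ) ≠ 0 := by
    exact_mod_cast (Real.sqrt_pos.2 (half_pos hB)).ne'
  refine ⟨(ξ 0 + Complex.I * ξ 1) / (2 * (√(B / 2) : ℝ)),
    (ξ 0 - Complex.I * ξ 1) / (2 * (√(B / 2) : ℝ)), fun x => ?_⟩
  rw [conj_landauCoord, landauCoord_apply, EuclideanSpace.inner_eq_star_dotProduct]
  generalize ((√(B / 2) : ℝ) : ℂ) = s at *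
  simp [dotProduct, Fin.sum_univ_two]
  field_simp
  linear_combination (2 * x 1 * ξ 1) * Complex.I_sq

/-- Multiplication by a linear form in `w` and `conj w` turns a Landau function into a combination
of its neighbours. Integrability is carried along the induction because the integral has to be
split. -/
theorem integral_pow_mul_landauFun_eq_zero {B : ℝ} (hB : 0 < B) {f : Plane → ℂ}
    (hf : MemLp f 2 volume) (h : ∀ m k, ∫ x, landauFun B m k x * f x = 0) (s t : ℂ) (n m k : ℕ) :
    Integrable (fun x => (s * conj (landauCoord B x) + t * landauCoord B x) ^ n *
      (landauFun B m k x * f x)) volume ∧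
    ∫ x, (s * conj (landauCoord B x) + t * landauCoord B x) ^ n *
      (landauFun B m k x * f x) = 0 := by
  induction n generalizing m k with
  | zero =>
    simp only [pow_zero, one_mul]
    exact ⟨(memLp_landauFun hB m k).integrable_mul hf, h m k⟩
  | succ n ih =>
    set L := fun x : Plane => s * conj (landauCoord B x) + t * landauCoord B x with hL
    have e : ∀ x, L x ^ (n + 1) * (landauFun B m k x * f x) =
        s * (L x ^ n * (landauFun B (m + 1) k x * f x)) +
        s * k * (L x ^ n * (landauFun B m (k - 1) x * f x)) +
        (t * (L x ^ n * (landauFun B m (k + 1) x * f x)) +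
        t * m * (L x ^ n * (landauFun B (m - 1) k x * f x))) := by
      intro x
      have h1 : L x * complexHermite m k (landauCoord B x) =
          s * (complexHermite (m + 1) k (landauCoord B x) +
            k * complexHermite m (k - 1) (landauCoord B x)) +
          t * (complexHermite m (k + 1) (landauCoord B x) +
            m * complexHermite (m - 1) k (landauCoord B x)) := by
        rw [← conj_mul_complexHermite, ← mul_complexHermite, hL]
        ring
      simp only [landauFun]
      rw [pow_succ]
      linear_combination (L x ^ n * (Real.exp (-(B / 4) * ‖x‖ ^ 2) : ℝ) * f x) * h1
    have ih' : ∀ m k, Integrable (fun x => L x ^ n * (landauFun B m k x * f x)) volume ∧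
        ∫ x, L x ^ n * (landauFun B m k x * f x) = 0 := ih
    have i1 := (ih' (m + 1) k).1.const_mul s
    have i2 := (ih' m (k - 1)).1.const_mul (s * k)
    have i3 := (ih' m (k + 1)).1.const_mul t
    have i4 := (ih' (m - 1) k).1.const_mul (t * m)
    change Integrable (fun x => L x ^ (n + 1) * (landauFun B m k x * f x)) volume ∧
      ∫ x, L x ^ (n + 1) * (landauFun B m k x * f x) = 0
    simp_rw [e]
    refine ⟨(i1.add i2).add (i3.add i4), ?_⟩
    have h12 := integral_add i1 i2
    have h34 := integral_add i3 i4
    have hall := integral_add (i1.add i2) (i3.add i4)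
    simp only [Pi.add_apply] at hall
    rw [hall, h12, h34]
    simp only [integral_const_mul, (ih' _ _).2, mul_zero, add_zero]

open scoped FourierTransform in
-- Expand the character in the Fourier transform of `Gaussian * f` into its power series: every term
-- integrates to zero against the Landau functions. Exchange of sum and integral is allowed because
-- `exp (κ ‖x‖)` times the Gaussian is still in `L²`. Since the Gaussian has no zeros, `f` vanishes.
theorem ae_eq_zero_of_integral_landauFun_eq_zero {B : ℝ} (hB : 0 < B) {f : Plane → ℂ}
    (hf : MemLp f 2 volume) (h : ∀ m k, ∫ x, landauFun B m k x * f x = 0) : ∀ᵐ x, f x = 0 := by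
  have hI : Integrable (fun x => landauFun B 0 0 x * f x) volume :=
    (memLp_landauFun hB 0 0).integrable_mul hf
  have hG : ∀ x, ‖landauFun B 0 0 x‖ = Real.exp (-(B / 4) * ‖x‖ ^ 2) := by
    intro x
    rw [landauFun, complexHermite_zero, pow_zero, one_mul, Complex.norm_real,
      Real.norm_of_nonneg (Real.exp_pos _).le]
  suffices hF : ∀ ξ, 𝓕 (fun x => landauFun B 0 0 x * f x) ξ = 0 by
    filter_upwards [ae_eq_zero_of_fourier_eq_zero hI hF] with x hx
    rcases mul_eq_zero.1 hx with h0 | h0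
    · have := hG x
      rw [h0, norm_zero] at this
      exact absurd this (Real.exp_pos _).ne
    · exact h0
  intro ξ
  obtain ⟨s, t, hst⟩ := exists_inner_eq_landauCoord hB ξ
  set L : Plane → ℂ := fun x => (-(2 * Real.pi * inner ℝ x ξ) : ℝ) * Complex.I with hL
  have hLst : ∀ x, L x = (-2 * Real.pi * Complex.I * s) * conj (landauCoord B x) +
      (-2 * Real.pi * Complex.I * t) * landauCoord B x := by
    intro x
    simp only [hL]
    push_cast
    rw [hst x]
    ring
  set κ := 2 * Real.pi * ‖ξ‖ with hκ
  have hLn : ∀ x, ‖L x‖ ≤ κ * ‖x‖ := by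
    intro x
    simp only [hL, norm_mul, Complex.norm_I, mul_one, Complex.norm_real, norm_neg]
    have := norm_inner_le_norm (𝕜 := ℝ) x ξ
    rw [Real.norm_of_nonneg (by positivity : (0 : ℝ) ≤ 2), Real.norm_of_nonneg Real.pi_pos.le, hκ]
    have hpi := Real.pi_pos
    calc 2 * Real.pi * ‖inner ℝ x ξ‖ ≤ 2 * Real.pi * (‖x‖ * ‖ξ‖) := by gcongr
      _ = _ := by ring
  have key := hasSum_integral_of_dominated_convergence (μ := (volume : Measure Plane))
    (F := fun (n : ℕ) x => (L x ^ n * (landauFun B 0 0 x * f x)) / n.factorial)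
    (f := fun x => Complex.exp (L x) * (landauFun B 0 0 x * f x))
    (fun (n : ℕ) x => ((κ * ‖x‖) ^ n / n.factorial) * ‖landauFun B 0 0 x * f x‖) ?_ ?_ ?_ ?_ ?_
  · have hzero : ∀ n : ℕ, ∫ x, (L x ^ n * (landauFun B 0 0 x * f x)) / n.factorial = 0 := by
      intro n
      rw [integral_div]
      simp_rw [hLst]
      rw [(integral_pow_mul_landauFun_eq_zero hB hf h _ _ n 0 0).2, zero_div]
    simp_rw [hzero] at key
    rw [Real.fourier_eq]
    rw [← key.unique hasSum_zero]
    congr 1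
    ext x
    rw [Circle.smul_def, Real.fourierChar_apply, smul_eq_mul]
    congr 2
    simp only [hL]
    push_cast
    ring
  · intro n
    have := (integral_pow_mul_landauFun_eq_zero hB hf h (-2 * Real.pi * Complex.I * s)
      (-2 * Real.pi * Complex.I * t) n 0 0).1.1
    simp_rw [← hLst] at this
    simp_rw [div_eq_mul_inv]
    exact this.mul_const _
  · intro n
    refine Filter.Eventually.of_forall fun x => ?_
    rw [norm_div, norm_mul, norm_pow, Complex.norm_natCast, mul_div_right_comm]
    gcongr
    exact hLn x
  · exact Filter.Eventually.of_forall fun x => (Real.summable_pow_div_factorial _).mul_right _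
  · have e : ∀ x : Plane, ∑' n : ℕ, ((κ * ‖x‖) ^ n / n.factorial) * ‖landauFun B 0 0 x * f x‖ =
        Real.exp (κ * ‖x‖ - B / 4 * ‖x‖ ^ 2) * ‖f x‖ := by
      intro x
      have h1 : ∑' n : ℕ, (κ * ‖x‖) ^ n / n.factorial = Real.exp (κ * ‖x‖) := by
        rw [Real.exp_eq_exp_ℝ, NormedSpace.exp_eq_tsum_div]
      rw [tsum_mul_right, h1, norm_mul, hG, sub_eq_add_neg, Real.exp_add, neg_mul]
      ring
    simp_rw [e]
    have hm : MemLp (fun x : Plane => Real.exp (κ * ‖x‖ - B / 4 * ‖x‖ ^ 2)) 2 volume := by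
      refine memLp_two_of_le_exp (a := B / 4) (C := 1) (κ := κ) (by positivity) ?_ fun x => ?_
      · exact Continuous.aestronglyMeasurable (by fun_prop)
      · rw [Real.norm_of_nonneg (Real.exp_pos _).le, one_mul]
    exact hm.integrable_mul hf.norm
  · refine Filter.Eventually.of_forall fun x => ?_
    have := (NormedSpace.expSeries_div_hasSum_exp (L x)).mul_right (landauFun B 0 0 x * f x)
    rw [← Complex.exp_eq_exp_ℂ] at this
    refine this.congr_fun fun n => ?_
    ring

/-! ### The Landau basis -/

/-- The constant normalizing `landauFun B m k` in `L²`. -/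
noncomputable def landauConst (B : ℝ) (m k : ℕ) : ℝ :=
  √(B / (2 * Real.pi) / (m.factorial * k.factorial))

theorem landauConst_sq {B : ℝ} (hB : 0 < B) (m k : ℕ) :
    landauConst B m k ^ 2 = B / (2 * Real.pi) / (m.factorial * k.factorial) := by
  have := Real.pi_pos
  exact Real.sq_sqrt (by positivity)

theorem landauConst_eq_succ {B : ℝ} (m k : ℕ) :
    landauConst B m k = √((m : ℝ) + 1) * landauConst B (m + 1) k := by
  have h : (0 : ℝ) ≤ (m : ℝ) + 1 := by positivity
  rw [landauConst, landauConst, ← Real.sqrt_mul h]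
  congr 1
  rw [Nat.factorial_succ]
  have := m.factorial_ne_zero
  have := k.factorial_ne_zero
  push_cast
  field_simp

theorem landauConst_mul_eq_pred {B : ℝ} (m k : ℕ) :
    landauConst B m k * m = √(m : ℝ) * landauConst B (m - 1) k := by
  rcases m with _ | m
  · simp
  · rw [Nat.add_sub_cancel, landauConst_eq_succ m k, ← mul_assoc]
    push_cast
    rw [Real.mul_self_sqrt (by positivity)]
    ring

/-- The Landau basis of `L²(ℝ²)`: `landauVec hB (m, k)` is the `k`-th vector of the `m`-th level. -/
noncomputable def landauVec {B : ℝ} (hB : 0 < B) (p : ℕ × ℕ) : L2Plane :=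
  (landauConst B p.1 p.2 : ℂ) • (memLp_landauFun hB p.1 p.2).toLp

theorem coeFn_landauVec {B : ℝ} (hB : 0 < B) (p : ℕ × ℕ) :
    landauVec hB p =ᵐ[volume] fun x => (landauConst B p.1 p.2 : ℂ) * landauFun B p.1 p.2 x := by
  filter_upwards [Lp.coeFn_smul (landauConst B p.1 p.2 : ℂ) (memLp_landauFun hB p.1 p.2).toLp,
    (memLp_landauFun hB p.1 p.2).coeFn_toLp] with x h1 h2
  rw [landauVec, h1, Pi.smul_apply, h2, smul_eq_mul]

theorem inner_landauVec {B : ℝ} (hB : 0 < B) (p : ℕ × ℕ) (u : L2Plane) :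
    inner ℂ (landauVec hB p) u =
      landauConst B p.1 p.2 * ∫ x, conj (landauFun B p.1 p.2 x) * u x := by
  rw [inner_eq_integral, ← integral_const_mul]
  refine integral_congr_ae ?_
  filter_upwards [coeFn_landauVec hB p] with x hx
  rw [hx, map_mul, Complex.conj_ofReal]
  ring

theorem orthonormal_landauVec {B : ℝ} (hB : 0 < B) : Orthonormal ℂ (landauVec hB) := by
  rw [orthonormal_iff_ite]
  rintro ⟨m, k⟩ ⟨m', k'⟩
  have h1 : ∫ x, conj (landauFun B m k x) * landauVec hB (m', k') x =
      landauConst B m' k' * ∫ x, conj (landauFun B m k x) * landauFun B m' k' x := by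
    rw [← integral_const_mul]
    refine integral_congr_ae ?_
    filter_upwards [coeFn_landauVec hB (m', k')] with x hx
    rw [hx]
    ring
  rw [inner_landauVec, h1, integral_landauFun hB]
  by_cases h : m = m' ∧ k = k'
  · obtain ⟨rfl, rfl⟩ := h
    simp only [and_self, if_true]
    rw [← Complex.ofReal_mul, ← Complex.ofReal_mul, ← mul_assoc, ← sq, landauConst_sq hB]
    have := m.factorial_ne_zero
    have := k.factorial_ne_zero
    have := Real.pi_ne_zero
    norm_cast
    field_simp
  · simp [h]

theorem span_landauVec_orthogonal {B : ℝ} (hB : 0 < B) :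
    (Submodule.span ℂ (Set.range (landauVec hB)))ᗮ = ⊥ := by
  rw [Submodule.eq_bot_iff]
  intro f hf
  rw [Lp.eq_zero_iff_ae_eq_zero]
  refine ae_eq_zero_of_integral_landauFun_eq_zero hB (Lp.memLp f) fun m k => ?_
  -- The inner product conjugates the Landau function, hence the swapped indices.
  have h1 : inner ℂ (landauVec hB (k, m)) f = 0 :=
    hf _ (Submodule.subset_span ⟨(k, m), rfl⟩)
  rw [inner_landauVec] at h1
  have h2 : (landauConst B k m : ℂ) ≠ 0 := by
    have := Real.pi_pos
    have h3 : 0 < landauConst B k m := Real.sqrt_pos.2 (by positivity)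
    exact_mod_cast h3.ne'
  simpa [conj_landauFun, h2] using h1

theorem hasSum_norm_inner_landauVec {B : ℝ} (hB : 0 < B) (u : L2Plane) :
    HasSum (fun p => ‖inner ℂ (landauVec hB p) u‖ ^ 2) (‖u‖ ^ 2) := by
  have h := (HilbertBasis.mkOfOrthogonalEqBot (orthonormal_landauVec hB)
    (span_landauVec_orthogonal hB)).hasSum_inner_mul_inner u u
  rw [HilbertBasis.coe_mkOfOrthogonalEqBot, inner_self_eq_norm_sq_to_K] at h
  rw [← Complex.hasSum_ofReal]
  convert! h using 1
  · ext p
    rw [← inner_conj_symm u, ← Complex.normSq_eq_norm_sq, Complex.normSq_eq_conj_mul_self]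
  · push_cast
    rfl

/-- The bound does not depend on `x`, `m` or `K`: in `sum_norm_complexHermite_le` the exponential
cancels the squared Gaussian, leaving the density of a full level. -/
theorem sum_norm_landauFun_le {B : ℝ} (hB : 0 < B) (m K : ℕ) (x : Plane) :
    ∑ k ∈ Finset.range K, ‖(landauConst B m k : ℂ) * landauFun B m k x‖ ^ 2 ≤
      B / (2 * Real.pi) := by
  have hpi := Real.pi_pos
  have h := sum_norm_complexHermite_le m K (landauCoord B x)
  rw [norm_landauCoord_sq hB.le] at h
  have e : ∀ k, ‖(landauConst B m k : ℂ) * landauFun B m k x‖ ^ 2 = (B / (2 * Real.pi) *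
      Real.exp (-(B / 2 * ‖x‖ ^ 2)) / m.factorial) *
      (‖complexHermite m k (landauCoord B x)‖ ^ 2 / k.factorial) := by
    intro k
    have e1 : Real.exp (-(B / 4) * ‖x‖ ^ 2) ^ 2 = Real.exp (-(B / 2 * ‖x‖ ^ 2)) := by
      rw [← Real.exp_nat_mul]; congr 1; push_cast; ring
    rw [norm_mul, mul_pow, Complex.norm_real, Real.norm_eq_abs, sq_abs, landauConst_sq hB,
      landauFun, norm_mul, mul_pow, Complex.norm_real, Real.norm_eq_abs, sq_abs, e1]
    have := m.factorial_ne_zero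
    have := k.factorial_ne_zero
    field_simp
  simp_rw [e]
  rw [← Finset.mul_sum]
  calc _ ≤ (B / (2 * Real.pi) * Real.exp (-(B / 2 * ‖x‖ ^ 2)) / m.factorial) *
        (m.factorial * Real.exp (B / 2 * ‖x‖ ^ 2)) := by gcongr
    _ = B / (2 * Real.pi) * (Real.exp (-(B / 2 * ‖x‖ ^ 2)) * Real.exp (B / 2 * ‖x‖ ^ 2)) := by
        have := m.factorial_ne_zero
        field_simp
    _ = _ := by rw [← Real.exp_add]; simp

/-! ### Weak derivatives in the Landau basis -/

theorem inner_landauVec_weakDeriv {B : ℝ} (hB : 0 < B) {j : Fin 2} {u g : L2Plane}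
    (h : IsWeakMagDeriv B j u g) (m k : ℕ) :
    inner ℂ (landauVec hB (m, k)) g =
      landauConst B m k * ∫ x, conj (magDeriv B j (landauFun B m k) x) * u x := by
  rw [inner_landauVec, ← integral_conj_magDeriv_of_memLp (Lp.memLp u) (Lp.memLp g) h
    (contDiff_landauFun B m k) (memLp_landauFun hB m k) (memLp_magDeriv_landauFun hB j m k)]

theorem integral_conj_landauFun_smul {B : ℝ} (hB : 0 < B) (u : L2Plane) (m k : ℕ) :
    (landauConst B m k * ∫ x, conj (landauFun B (m + 1) k x) * u x =
      √((m : ℝ) + 1) * inner ℂ (landauVec hB (m + 1, k)) u) ∧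
    (landauConst B m k * (m * ∫ x, conj (landauFun B (m - 1) k x) * u x) =
      √(m : ℝ) * inner ℂ (landauVec hB (m - 1, k)) u) := by
  rw [inner_landauVec, inner_landauVec]
  constructor
  · rw [landauConst_eq_succ m k]
    push_cast
    ring
  · have := congrArg (fun t : ℝ => (t : ℂ)) (landauConst_mul_eq_pred (B := B) m k)
    push_cast at this
    linear_combination (∫ x, conj (landauFun B (m - 1) k x) * u x) * this

theorem inner_landauVec_weakDeriv_zero {B : ℝ} (hB : 0 < B) {u g : L2Plane}
    (h : IsWeakMagDeriv B 0 u g) (m k : ℕ) :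
    inner ℂ (landauVec hB (m, k)) g = -(Complex.I * (√(B / 2) : ℝ)) *
      (√((m : ℝ) + 1) * inner ℂ (landauVec hB (m + 1, k)) u -
        √(m : ℝ) * inner ℂ (landauVec hB (m - 1, k)) u) := by
  obtain ⟨h1, h2⟩ := integral_conj_landauFun_smul hB u m k
  have hI : ∀ a, Integrable (fun x => conj (landauFun B a k x) * u x) volume :=
    fun a => integrable_conj_mul (memLp_landauFun hB a k) (Lp.memLp u)
  rw [inner_landauVec_weakDeriv hB h, ← h1, ← h2]
  have e : ∫ x, conj (magDeriv B 0 (landauFun B m k) x) * u x = -(Complex.I * (√(B / 2) : ℝ)) *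
      ((∫ x, conj (landauFun B (m + 1) k x) * u x) -
        m * ∫ x, conj (landauFun B (m - 1) k x) * u x) := by
    rw [← integral_const_mul (m : ℂ), ← integral_sub (hI _) ((hI _).const_mul _),
      ← integral_const_mul]
    congr 1
    ext x
    rw [magDeriv_zero_landauFun hB.le]
    simp only [map_mul, map_sub, Complex.conj_I, Complex.conj_ofReal, map_natCast]
    ring
  rw [e]
  ring

theorem inner_landauVec_weakDeriv_one {B : ℝ} (hB : 0 < B) {u g : L2Plane}
    (h : IsWeakMagDeriv B 1 u g) (m k : ℕ) :
    inner ℂ (landauVec hB (m, k)) g = -((√(B / 2) : ℝ)) *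
      (√((m : ℝ) + 1) * inner ℂ (landauVec hB (m + 1, k)) u +
        √(m : ℝ) * inner ℂ (landauVec hB (m - 1, k)) u) := by
  obtain ⟨h1, h2⟩ := integral_conj_landauFun_smul hB u m k
  have hI : ∀ a, Integrable (fun x => conj (landauFun B a k x) * u x) volume :=
    fun a => integrable_conj_mul (memLp_landauFun hB a k) (Lp.memLp u)
  rw [inner_landauVec_weakDeriv hB h, ← h1, ← h2]
  have e : ∫ x, conj (magDeriv B 1 (landauFun B m k) x) * u x = -((√(B / 2) : ℝ)) *
      ((∫ x, conj (landauFun B (m + 1) k x) * u x) +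
        m * ∫ x, conj (landauFun B (m - 1) k x) * u x) := by
    rw [← integral_const_mul (m : ℂ), ← integral_add (hI _) ((hI _).const_mul _),
      ← integral_const_mul]
    congr 1
    ext x
    rw [magDeriv_one_landauFun hB.le]
    simp only [map_mul, map_add, map_neg, Complex.conj_ofReal, map_natCast]
    ring
  rw [e]
  ring

/-- The two coefficients are a difference and a sum of the same ladder terms, up to unimodular
factors; by the parallelogram law the cross terms cancel. -/
theorem norm_inner_weakDeriv_sq_add {B : ℝ} (hB : 0 < B) {u g₀ g₁ : L2Plane}
    (h₀ : IsWeakMagDeriv B 0 u g₀) (h₁ : IsWeakMagDeriv B 1 u g₁) (m k : ℕ) :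
    ‖inner ℂ (landauVec hB (m, k)) g₀‖ ^ 2 + ‖inner ℂ (landauVec hB (m, k)) g₁‖ ^ 2 =
      B * ((m + 1) * ‖inner ℂ (landauVec hB (m + 1, k)) u‖ ^ 2 +
        m * ‖inner ℂ (landauVec hB (m - 1, k)) u‖ ^ 2) := by
  rw [inner_landauVec_weakDeriv_zero hB h₀, inner_landauVec_weakDeriv_one hB h₁]
  generalize inner ℂ (landauVec hB (m + 1, k)) u = a
  generalize inner ℂ (landauVec hB (m - 1, k)) u = b
  have hs : √(B / 2) ^ 2 = B / 2 := Real.sq_sqrt (by positivity)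
  have ha : ‖(√((m : ℝ) + 1) : ℂ) * a‖ ^ 2 = (m + 1) * ‖a‖ ^ 2 := by
    rw [norm_mul, mul_pow, Complex.norm_real, Real.norm_eq_abs, sq_abs,
      Real.sq_sqrt (by positivity)]
  have hb : ‖(√(m : ℝ) : ℂ) * b‖ ^ 2 = m * ‖b‖ ^ 2 := by
    rw [norm_mul, mul_pow, Complex.norm_real, Real.norm_eq_abs, sq_abs,
      Real.sq_sqrt (by positivity)]
  have hp := parallelogram_law_with_norm ℝ ((√((m : ℝ) + 1) : ℂ) * a) ((√(m : ℝ) : ℂ) * b)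
  rw [norm_mul, norm_mul, mul_pow, mul_pow, norm_neg, norm_neg, norm_mul, Complex.norm_I, one_mul,
    Complex.norm_real, Real.norm_eq_abs, sq_abs, hs, ← ha, ← hb]
  linear_combination (B / 2) * hp

/-- The spectral lower bound for the energy, restricted to finitely many Landau states. -/
theorem sum_levels_le {B : ℝ} (hB : 0 < B) {u g₀ g₁ : L2Plane}
    (h₀ : IsWeakMagDeriv B 0 u g₀) (h₁ : IsWeakMagDeriv B 1 u g₁) (M K : ℕ) :
    B * ∑ m ∈ Finset.range M, ∑ k ∈ Finset.range K,
      (2 * (m : ℝ) + 1) * ‖inner ℂ (landauVec hB (m, k)) u‖ ^ 2 ≤ ‖g₀‖ ^ 2 + ‖g₁‖ ^ 2 := by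
  -- Level `m` of `u` receives weight `m` from coefficient `m - 1` of the derivatives and `m + 1`
  -- from coefficient `m + 1`. One extra level is therefore needed to complete the weight `2m + 1`
  -- up to `m = M - 1`.
  set S := Finset.range (M + 1) ×ˢ Finset.range K with hS
  have b0 := (orthonormal_landauVec hB).sum_inner_products_le g₀ (s := S)
  have b1 := (orthonormal_landauVec hB).sum_inner_products_le g₁ (s := S)
  refine le_trans ?_ (add_le_add b0 b1)
  rw [← Finset.sum_add_distrib, hS, Finset.sum_product]
  simp_rw [norm_inner_weakDeriv_sq_add hB h₀ h₁, ← Finset.mul_sum]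
  refine mul_le_mul_of_nonneg_left ?_ hB.le
  set a : ℕ → ℝ := fun m => ∑ k ∈ Finset.range K, ‖inner ℂ (landauVec hB (m, k)) u‖ ^ 2 with ha
  have ha0 : ∀ m, 0 ≤ a m := fun m => Finset.sum_nonneg fun _ _ => by positivity
  have e : ∀ m : ℕ, ∑ k ∈ Finset.range K,
      (((m : ℝ) + 1) * ‖inner ℂ (landauVec hB (m + 1, k)) u‖ ^ 2 +
      m * ‖inner ℂ (landauVec hB (m - 1, k)) u‖ ^ 2) = (m + 1) * a (m + 1) + m * a (m - 1) := by
    intro m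
    rw [Finset.sum_add_distrib, ← Finset.mul_sum, ← Finset.mul_sum]
  simp_rw [e]
  rw [Finset.sum_add_distrib, Finset.sum_range_succ' (fun m : ℕ => (m : ℝ) * a (m - 1))]
  have e2 : ∑ m ∈ Finset.range (M + 1), ((m : ℝ) + 1) * a (m + 1) ≥
      ∑ m ∈ Finset.range M, (m : ℝ) * a m := by
    have h1 : ∑ m ∈ Finset.range (M + 1 + 1), (m : ℝ) * a m =
        ∑ m ∈ Finset.range (M + 1), ((m : ℝ) + 1) * a (m + 1) := by
      rw [Finset.sum_range_succ']; simp
    rw [← h1]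
    refine Finset.sum_le_sum_of_subset_of_nonneg (Finset.range_mono (by omega)) fun m _ _ => ?_
    have := ha0 m
    positivity
  have e3 : ∑ m ∈ Finset.range M, (2 * (m : ℝ) + 1) * a m = ∑ m ∈ Finset.range M, (m : ℝ) * a m +
      ∑ m ∈ Finset.range M, ((m + 1 : ℕ) : ℝ) * a (m + 1 - 1) := by
    rw [← Finset.sum_add_distrib]
    refine Finset.sum_congr rfl fun m _ => ?_
    push_cast
    ring
  change ∑ m ∈ Finset.range M, (2 * (m : ℝ) + 1) * a m ≤ _
  rw [e3]
  push_cast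
  simp only [zero_mul, add_zero]
  linarith

/-! ### The kinetic energy inequality -/

/-- The orthogonal projection of `u` onto the span of the first `K` states of the first `n` Landau
levels. -/
noncomputable def landauProj {B : ℝ} (hB : 0 < B) (n K : ℕ) (u : L2Plane) : L2Plane :=
  ∑ p ∈ Finset.range n ×ˢ Finset.range K, inner ℂ (landauVec hB p) u • landauVec hB p

theorem Orthonormal.norm_sum_smul_sq {𝕜 H ι : Type*} [RCLike 𝕜] [NormedAddCommGroup H]
    [InnerProductSpace 𝕜 H] {e : ι → H} (he : Orthonormal 𝕜 e) (s : Finset ι) (a : ι → 𝕜) :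
    ‖∑ p ∈ s, a p • e p‖ ^ 2 = ∑ p ∈ s, ‖a p‖ ^ 2 := by
  rw [← inner_self_eq_norm_sq (𝕜 := 𝕜), he.inner_sum, map_sum]
  refine Finset.sum_congr rfl fun p _ => ?_
  rw [RCLike.conj_mul]
  norm_cast

theorem Orthonormal.norm_sub_sum_inner_smul_sq {𝕜 H ι : Type*} [RCLike 𝕜] [NormedAddCommGroup H]
    [InnerProductSpace 𝕜 H] {e : ι → H} (he : Orthonormal 𝕜 e) (s : Finset ι) (u : H) :
    ‖u - ∑ p ∈ s, inner 𝕜 (e p) u • e p‖ ^ 2 = ‖u‖ ^ 2 - ∑ p ∈ s, ‖inner 𝕜 (e p) u‖ ^ 2 := by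
  have h1 : RCLike.re (inner 𝕜 u (∑ p ∈ s, inner 𝕜 (e p) u • e p)) =
      ∑ p ∈ s, ‖inner 𝕜 (e p) u‖ ^ 2 := by
    rw [inner_sum, map_sum]
    refine Finset.sum_congr rfl fun p _ => ?_
    rw [inner_smul_right, ← inner_conj_symm u, RCLike.mul_conj]
    norm_cast
  rw [norm_sub_sq (𝕜 := 𝕜), h1, he.norm_sum_smul_sq]
  ring

theorem norm_sub_landauProj_sq {B : ℝ} (hB : 0 < B) (n K : ℕ) (u : L2Plane) :
    ‖u - landauProj hB n K u‖ ^ 2 = ‖u‖ ^ 2 -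
      ∑ m ∈ Finset.range n, ∑ k ∈ Finset.range K, ‖inner ℂ (landauVec hB (m, k)) u‖ ^ 2 := by
  rw [landauProj, (orthonormal_landauVec hB).norm_sub_sum_inner_smul_sq, Finset.sum_product]

theorem coeFn_landauProj {B : ℝ} (hB : 0 < B) (n K : ℕ) (u : L2Plane) :
    landauProj hB n K u =ᵐ[volume] fun x => ∑ p ∈ Finset.range n ×ˢ Finset.range K,
      inner ℂ (landauVec hB p) u * (landauConst B p.1 p.2 * landauFun B p.1 p.2 x) := by
  have h1 : ∀ p, ∀ᵐ x, (inner ℂ (landauVec hB p) u • landauVec hB p : L2Plane) x =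
      inner ℂ (landauVec hB p) u * (landauConst B p.1 p.2 * landauFun B p.1 p.2 x) := by
    intro p
    filter_upwards [Lp.coeFn_smul (inner ℂ (landauVec hB p) u) (landauVec hB p),
      coeFn_landauVec hB p] with x h1 h2
    rw [h1, Pi.smul_apply, h2, smul_eq_mul]
  filter_upwards [Lp.coeFn_finsetSum (p := 2) (μ := (volume : Measure Plane))
    (Finset.range n ×ˢ Finset.range K) fun p => inner ℂ (landauVec hB p) u • landauVec hB p,
    ae_all_iff.2 h1] with x h2 h3
  rw [landauProj, h2, Finset.sum_apply]
  exact Finset.sum_congr rfl fun p _ => h3 p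

/-- A finite family `ψ` is a Bessel family with bound one if `∑ |⟪ψ i, f⟫|² ≤ ‖f‖²`, that is, if
`∑ |ψ i⟩⟨ψ i| ≤ 1`. -/
def IsBesselFamily {ι H : Type*} [Fintype ι] [NormedAddCommGroup H] [InnerProductSpace ℂ H]
    (ψ : ι → H) : Prop :=
  ∀ f : H, ∑ i, ‖inner ℂ (ψ i) f‖ ^ 2 ≤ ‖f‖ ^ 2

/-- The density of the operator `∑ |ψ i⟩⟨ψ i|`. -/
noncomputable def density {ι : Type*} [Fintype ι] (ψ : ι → L2Plane) (x : Plane) : ℝ :=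
  ∑ i, ‖ψ i x‖ ^ 2

theorem density_nonneg {ι : Type*} [Fintype ι] (ψ : ι → L2Plane) (x : Plane) : 0 ≤ density ψ x :=
  Finset.sum_nonneg fun _ _ => by positivity

theorem integrable_norm_sq (u : L2Plane) : Integrable (fun x => ‖u x‖ ^ 2) volume :=
  (memLp_two_iff_integrable_sq_norm (Lp.aestronglyMeasurable u)).1 (Lp.memLp u)

theorem norm_sq_eq_integral (u : L2Plane) : ‖u‖ ^ 2 = ∫ x, ‖u x‖ ^ 2 := by
  rw [← inner_self_eq_norm_sq (𝕜 := ℂ), inner_eq_integral]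
  have : ∀ x, conj (u x) * u x = ((‖u x‖ ^ 2 : ℝ) : ℂ) := by
    intro x
    rw [← Complex.normSq_eq_norm_sq, Complex.normSq_eq_conj_mul_self]
  simp_rw [this]
  rw [integral_complex_ofReal]
  rfl

theorem integrable_density {ι : Type*} [Fintype ι] (ψ : ι → L2Plane) :
    Integrable (density ψ) volume :=
  integrable_finsetSum _ fun i _ => integrable_norm_sq (ψ i)

theorem integral_density {ι : Type*} [Fintype ι] (ψ : ι → L2Plane) :
    ∫ x, density ψ x = ∑ i, ‖ψ i‖ ^ 2 := by
  unfold density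
  rw [integral_finsetSum _ fun i _ => integrable_norm_sq (ψ i)]
  simp_rw [norm_sq_eq_integral]

/-- Evaluation at `x` of the projected function is the inner product with the reproducing kernel
`F`. The Bessel property bounds the sum by `‖F‖²`, which is the density of the finite-rank
projection at `x`. -/
theorem sum_norm_landauProj_le {ι : Type*} [Fintype ι] {B : ℝ} (hB : 0 < B) {ψ : ι → L2Plane}
    (hψ : IsBesselFamily ψ) (n K : ℕ) (x : Plane) :
    ∑ i, ‖∑ p ∈ Finset.range n ×ˢ Finset.range K, inner ℂ (landauVec hB p) (ψ i) *
      (landauConst B p.1 p.2 * landauFun B p.1 p.2 x)‖ ^ 2 ≤ n * (B / (2 * Real.pi)) := by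
  set A : ℕ × ℕ → ℂ := fun p => landauConst B p.1 p.2 * landauFun B p.1 p.2 x with hA
  set S := Finset.range n ×ˢ Finset.range K
  set F : L2Plane := ∑ p ∈ S, conj (A p) • landauVec hB p with hF
  have h1 : ∀ i, ‖∑ p ∈ S, inner ℂ (landauVec hB p) (ψ i) * A p‖ = ‖inner ℂ (ψ i) F‖ := by
    intro i
    rw [norm_inner_symm, hF, sum_inner]
    congr 1
    refine Finset.sum_congr rfl fun p _ => ?_
    rw [inner_smul_left, RCLike.conj_conj, mul_comm]
  change ∑ i, ‖∑ p ∈ S, inner ℂ (landauVec hB p) (ψ i) * A p‖ ^ 2 ≤ _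
  simp_rw [h1]
  refine (hψ F).trans ?_
  rw [hF, (orthonormal_landauVec hB).norm_sum_smul_sq, Finset.sum_product]
  simp_rw [RCLike.norm_conj]
  calc _ ≤ ∑ m ∈ Finset.range n, B / (2 * Real.pi) :=
        Finset.sum_le_sum fun m _ => sum_norm_landauFun_le hB m K x
    _ = _ := by simp

/-- The function `(√ρ - √(n B / 2π))₊²`. -/
noncomputable def densityGap (B : ℝ) (n : ℕ) (ρ : ℝ) : ℝ :=
  max (√ρ - √(n * (B / (2 * Real.pi)))) 0 ^ 2

theorem densityGap_nonneg (B : ℝ) (n : ℕ) (ρ : ℝ) : 0 ≤ densityGap B n ρ := by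
  unfold densityGap; positivity

theorem continuous_densityGap (B : ℝ) (n : ℕ) : Continuous (densityGap B n) := by
  unfold densityGap; fun_prop

/-- Triangle inequality in `ℓ²(ι)`, at a fixed point of the plane: `a` stands for the values of the
family and `b` for those of its projection. -/
theorem densityGap_le {ι : Type*} [Fintype ι] (B : ℝ) (n : ℕ) (a b : ι → ℂ)
    (hb : ∑ i, ‖b i‖ ^ 2 ≤ n * (B / (2 * Real.pi))) :
    densityGap B n (∑ i, ‖a i‖ ^ 2) ≤ ∑ i, ‖a i - b i‖ ^ 2 := by
  have h1 : √(∑ i, ‖a i‖ ^ 2) ≤ √(∑ i, ‖a i - b i‖ ^ 2) + √(∑ i, ‖b i‖ ^ 2) := by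
    have := norm_add_le (WithLp.toLp 2 (fun i => a i - b i) : EuclideanSpace ℂ ι) (WithLp.toLp 2 b)
    rw [EuclideanSpace.norm_eq, EuclideanSpace.norm_eq, EuclideanSpace.norm_eq] at this
    simpa using this
  have h2 : √(∑ i, ‖b i‖ ^ 2) ≤ √(n * (B / (2 * Real.pi))) := Real.sqrt_le_sqrt hb
  rw [densityGap, ← Real.sq_sqrt (Finset.sum_nonneg fun i _ => by positivity :
    0 ≤ ∑ i, ‖a i - b i‖ ^ 2)]
  gcongr
  exact max_le (by linarith) (Real.sqrt_nonneg _)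

theorem integrable_densityGap {ι : Type*} [Fintype ι] (B : ℝ) (n : ℕ) (ψ : ι → L2Plane) :
    Integrable (fun x => densityGap B n (density ψ x)) volume := by
  refine (integrable_density ψ).mono'
    ((continuous_densityGap B n).comp_aestronglyMeasurable (integrable_density ψ).1) ?_
  refine Filter.Eventually.of_forall fun x => ?_
  rw [Real.norm_of_nonneg (densityGap_nonneg _ _ _), densityGap]
  conv_rhs => rw [← Real.sq_sqrt (density_nonneg ψ x)]
  gcongr
  exact max_le (by linarith [Real.sqrt_nonneg (n * (B / (2 * Real.pi)))]) (Real.sqrt_nonneg _)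

theorem integral_densityGap_le {ι : Type*} [Fintype ι] {B : ℝ} (hB : 0 < B) {ψ : ι → L2Plane}
    (hψ : IsBesselFamily ψ) (n K : ℕ) :
    ∫ x, densityGap B n (density ψ x) ≤ ∑ i, ‖ψ i - landauProj hB n K (ψ i)‖ ^ 2 := by
  simp_rw [norm_sq_eq_integral (ψ _ - landauProj hB n K (ψ _))]
  rw [← integral_finsetSum _ fun i _ => integrable_norm_sq _]
  refine integral_mono_ae (integrable_densityGap B n ψ)
    (integrable_finsetSum _ fun i _ => integrable_norm_sq _) ?_
  have h1 : ∀ i, ∀ᵐ x, (ψ i - landauProj hB n K (ψ i)) x = ψ i x -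
      ∑ p ∈ Finset.range n ×ˢ Finset.range K, inner ℂ (landauVec hB p) (ψ i) *
        (landauConst B p.1 p.2 * landauFun B p.1 p.2 x) := by
    intro i
    filter_upwards [Lp.coeFn_sub (ψ i) (landauProj hB n K (ψ i)),
      coeFn_landauProj hB n K (ψ i)] with x h1 h2
    rw [h1, Pi.sub_apply, h2]
  filter_upwards [ae_all_iff.2 h1] with x hx
  simp_rw [hx]
  exact densityGap_le B n _ _ (sum_norm_landauProj_le hB hψ n K x)

/-- Layer-cake counting: `2m + 1` is at least one plus twice the number of `n < N` with `n < m`, and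
the mass above level `n` is what `landauProj` with `n + 1` levels leaves over. -/
theorem energy_lower_bound {B : ℝ} (hB : 0 < B) {u g₀ g₁ : L2Plane}
    (h₀ : IsWeakMagDeriv B 0 u g₀) (h₁ : IsWeakMagDeriv B 1 u g₁) (N : ℕ) {ε : ℝ} (hε : 0 < ε) :
    ∀ᶠ K in Filter.atTop, B * (‖u‖ ^ 2 + 2 * ∑ n ∈ Finset.range N,
      ‖u - landauProj hB (n + 1) K u‖ ^ 2) ≤ ‖g₀‖ ^ 2 + ‖g₁‖ ^ 2 + ε := by
  -- Truncation loses mass at most `δ`, once in the first term and `2N` times in the sum, each with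
  -- the factor `B`.
  set δ := ε / (B * (2 * N + 1)) with hδ
  have hδ0 : 0 < δ := by positivity
  set a : ℕ × ℕ → ℝ := fun p => ‖inner ℂ (landauVec hB p) u‖ ^ 2 with ha
  have ha0 : ∀ p, 0 ≤ a p := fun p => by positivity
  have hsum : HasSum a (‖u‖ ^ 2) := hasSum_norm_inner_landauVec hB u
  obtain ⟨S, hS⟩ := (hsum.eventually (lt_mem_nhds (sub_lt_self (‖u‖ ^ 2) hδ0))).exists
  -- The summand `N` guarantees that all subtracted levels lie below the truncation `M`.
  set M := S.sup Prod.fst + 1 + N with hM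
  filter_upwards [Filter.eventually_gt_atTop (S.sup Prod.snd)] with K hK
  have hsub : S ⊆ Finset.range M ×ˢ Finset.range K := by
    intro p hp
    rw [Finset.mem_product, Finset.mem_range, Finset.mem_range]
    have h1 : p.1 ≤ S.sup Prod.fst := Finset.le_sup hp
    have h2 : p.2 ≤ S.sup Prod.snd := Finset.le_sup hp
    omega
  set b : ℕ → ℝ := fun m => ∑ k ∈ Finset.range K, a (m, k) with hb
  have hb0 : ∀ m, 0 ≤ b m := fun m => Finset.sum_nonneg fun k _ => ha0 _
  have hT : ‖u‖ ^ 2 - δ ≤ ∑ m ∈ Finset.range M, b m := by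
    have := Finset.sum_le_sum_of_subset_of_nonneg hsub fun p _ _ => ha0 p
    rw [Finset.sum_product] at this
    exact hS.le.trans this
  have hE : B * ∑ m ∈ Finset.range M, (2 * (m : ℝ) + 1) * b m ≤ ‖g₀‖ ^ 2 + ‖g₁‖ ^ 2 := by
    have := sum_levels_le hB h₀ h₁ M K
    simpa only [hb, ha, Finset.mul_sum] using this
  set T := ∑ m ∈ Finset.range M, b m with hTdef
  have hcount : T + 2 * ∑ n ∈ Finset.range N, (T - ∑ m ∈ Finset.range (n + 1), b m) ≤
      ∑ m ∈ Finset.range M, (2 * (m : ℝ) + 1) * b m := by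
    have h1 : ∀ n ∈ Finset.range N, T - ∑ m ∈ Finset.range (n + 1), b m =
        ∑ m ∈ Finset.range M, if n < m then b m else 0 := by
      intro n hn
      have hn' : n + 1 ≤ M := by have := Finset.mem_range.1 hn; omega
      rw [hTdef, ← Finset.sum_range_add_sum_Ico b hn', add_sub_cancel_left, ← Finset.sum_filter]
      congr 1
      ext m
      simp only [Finset.mem_Ico, Finset.mem_filter, Finset.mem_range]
      omega
    rw [Finset.sum_congr rfl h1, Finset.sum_comm, Finset.mul_sum, hTdef, ← Finset.sum_add_distrib]
    refine Finset.sum_le_sum fun m _ => ?_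
    rw [← Finset.sum_filter, Finset.sum_const, nsmul_eq_mul]
    have hc : ((Finset.range N).filter (fun n => n < m)).card ≤ m := by
      calc _ ≤ (Finset.range m).card := Finset.card_le_card fun n hn => by
            simpa using (Finset.mem_filter.1 hn).2
        _ = m := Finset.card_range m
    have hc' : (((Finset.range N).filter (fun n => n < m)).card : ℝ) ≤ m := by exact_mod_cast hc
    nlinarith [hb0 m, mul_le_mul_of_nonneg_right hc' (hb0 m)]
  simp_rw [norm_sub_landauProj_sq]
  change B * (‖u‖ ^ 2 + 2 * ∑ n ∈ Finset.range N, (‖u‖ ^ 2 - ∑ m ∈ Finset.range (n + 1), b m)) ≤ _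
  have hfin : ‖u‖ ^ 2 + 2 * ∑ n ∈ Finset.range N, (‖u‖ ^ 2 - ∑ m ∈ Finset.range (n + 1), b m) ≤
      T + 2 * ∑ n ∈ Finset.range N, (T - ∑ m ∈ Finset.range (n + 1), b m) + (2 * N + 1) * δ := by
    rw [Finset.sum_sub_distrib, Finset.sum_sub_distrib, Finset.sum_const, Finset.sum_const,
      Finset.card_range, nsmul_eq_mul, nsmul_eq_mul]
    have hN : (0 : ℝ) ≤ N := by positivity
    nlinarith
  calc _ ≤ B * (∑ m ∈ Finset.range M, (2 * (m : ℝ) + 1) * b m + (2 * N + 1) * δ) := by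
        exact mul_le_mul_of_nonneg_left (by linarith) hB.le
    _ = B * ∑ m ∈ Finset.range M, (2 * (m : ℝ) + 1) * b m + ε := by
        rw [hδ]; field_simp
    _ ≤ _ := by linarith

/-- **Kinetic energy inequality** for the Landau Hamiltonian, with finitely many levels. -/
theorem kinetic_energy_le {ι : Type*} [Fintype ι] {B : ℝ} (hB : 0 < B) {ψ g₀ g₁ : ι → L2Plane}
    (hψ : IsBesselFamily ψ) (h₀ : ∀ i, IsWeakMagDeriv B 0 (ψ i) (g₀ i))
    (h₁ : ∀ i, IsWeakMagDeriv B 1 (ψ i) (g₁ i)) (N : ℕ) :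
    B * (∫ x, density ψ x) + 2 * B * ∑ n ∈ Finset.range N, ∫ x, densityGap B (n + 1) (density ψ x) ≤
      ∑ i, (‖g₀ i‖ ^ 2 + ‖g₁ i‖ ^ 2) := by
  refine le_of_forall_pos_le_add fun ε hε => ?_
  set δ := ε / (Fintype.card ι + 1) with hδ
  have hδ0 : 0 < δ := by positivity
  obtain ⟨K, hK⟩ := (Filter.eventually_all.2
    fun i => energy_lower_bound hB (h₀ i) (h₁ i) N hδ0).exists
  have h1 := Finset.sum_le_sum fun i (_ : i ∈ Finset.univ) => hK i
  rw [Finset.sum_add_distrib, ← Finset.mul_sum, Finset.sum_add_distrib, ← Finset.mul_sum,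
    Finset.sum_comm, Finset.sum_const, Finset.card_univ, nsmul_eq_mul] at h1
  have h2 : ∑ n ∈ Finset.range N, ∫ x, densityGap B (n + 1) (density ψ x) ≤
      ∑ n ∈ Finset.range N, ∑ i, ‖ψ i - landauProj hB (n + 1) K (ψ i)‖ ^ 2 :=
    Finset.sum_le_sum fun n _ => integral_densityGap_le hB hψ (n + 1) K
  have h3 : (Fintype.card ι : ℝ) * δ ≤ ε := by
    rw [hδ, mul_div_assoc', div_le_iff₀ (by positivity)]
    nlinarith
  rw [integral_density]
  nlinarith

/-! ### The Lieb–Thirring bound for Bessel families -/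

/-- The sum `∑ ((2 m + 1) B + t)₋` over the Landau levels. -/
noncomputable def levelSum (B t : ℝ) : ℝ≥0∞ :=
  ∑' m : ℕ, ENNReal.ofReal (max (-((2 * (m : ℝ) + 1) * B + t)) 0)

theorem measurable_levelSum (B : ℝ) : Measurable (levelSum B) := by
  unfold levelSum
  exact Measurable.tsum fun m => by fun_prop

theorem lintegral_levelSum (B : ℝ) {V : Plane → ℝ} (hV : AEMeasurable V volume) :
    ∫⁻ x, levelSum B (V x) =
      ∑' m : ℕ, ∫⁻ x : Plane, ENNReal.ofReal (max (-((2 * (m : ℝ) + 1) * B + V x)) 0) := by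
  unfold levelSum
  exact lintegral_tsum fun m => by fun_prop

/-- After the factor 2 is taken out, the levels are `(m + 1)B`. The even `m` reproduce the original
levels, and the odd `m` give levels higher by `B`, which contribute no more. -/
theorem levelSum_two_mul_add_le {B : ℝ} (hB : 0 ≤ B) (t : ℝ) :
    levelSum B (2 * t + B) ≤ 4 * levelSum B t := by
  have e1 : levelSum B (2 * t + B) =
      ∑' m : ℕ, 2 * ENNReal.ofReal (max (-(((m : ℝ) + 1) * B + t)) 0) := by
    refine tsum_congr fun m => ?_
    have : max (-((2 * (m : ℝ) + 1) * B + (2 * t + B))) 0 =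
        2 * max (-(((m : ℝ) + 1) * B + t)) 0 := by
      rw [mul_max_of_nonneg _ _ (by norm_num : (0 : ℝ) ≤ 2)]
      congr 1 <;> ring
    rw [this, ENNReal.ofReal_mul zero_le_two, ENNReal.ofReal_ofNat]
  rw [e1, ENNReal.tsum_mul_left, ← tsum_even_add_odd ENNReal.summable ENNReal.summable]
  have h1 : ∑' k : ℕ, ENNReal.ofReal (max (-((((2 * k : ℕ) : ℝ) + 1) * B + t)) 0) ≤
      levelSum B t := by
    refine ENNReal.tsum_le_tsum fun k => le_of_eq ?_
    push_cast
    rfl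
  have h2 : ∑' k : ℕ, ENNReal.ofReal (max (-((((2 * k + 1 : ℕ) : ℝ) + 1) * B + t)) 0) ≤
      levelSum B t := by
    refine ENNReal.tsum_le_tsum fun k => ENNReal.ofReal_le_ofReal (max_le_max_right _ ?_)
    push_cast
    nlinarith
  calc _ ≤ 2 * (levelSum B t + levelSum B t) := by gcongr
    _ = 4 * levelSum B t := by rw [← two_mul, ← mul_assoc]; norm_num

/-- `mul_le_levels` in physical units: `c = B/2π` is the density per level, and the scalar
inequality is multiplied by `c * B`. Working in `ℝ≥0∞` lets the finite sums be replaced by full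
series without convergence questions. -/
theorem ofReal_neg_mul_le {B : ℝ} (hB : 0 < B) (t : ℝ) {ρ : ℝ} (hρ : 0 ≤ ρ) :
    ENNReal.ofReal (-t * ρ) ≤ ENNReal.ofReal (B * ρ) +
      (∑' n : ℕ, ENNReal.ofReal (2 * B * densityGap B (n + 1) ρ)) +
      3 * (ENNReal.ofReal (B / (2 * Real.pi)) * levelSum B t) := by
  have hpi := Real.pi_pos
  set c := B / (2 * Real.pi) with hc
  have hc0 : 0 < c := by positivity
  obtain ⟨N, hN⟩ := mul_le_levels (y := -t / B) (r := ρ / c) (by positivity)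
  have hgap : ∀ n : ℕ, c * max (√(ρ / c) - √((n : ℝ) + 1)) 0 ^ 2 = densityGap B (n + 1) ρ := by
    intro n
    have h1 : √c * max (√(ρ / c) - √((n : ℝ) + 1)) 0 =
        max (√ρ - √(((n + 1 : ℕ) : ℝ) * c)) 0 := by
      rw [mul_max_of_nonneg _ _ (Real.sqrt_nonneg c), mul_zero, mul_sub, ← Real.sqrt_mul hc0.le,
        ← Real.sqrt_mul hc0.le, mul_div_cancel₀ _ hc0.ne']
      push_cast
      rw [mul_comm c]
    rw [densityGap, ← h1, mul_pow, Real.sq_sqrt hc0.le]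
  have hlev : ∀ m : ℕ,
      B * max (-t / B - (2 * (m : ℝ) + 1)) 0 = max (-((2 * (m : ℝ) + 1) * B + t)) 0 := by
    intro m
    rw [mul_max_of_nonneg _ _ hB.le, mul_zero]
    congr 1
    field_simp
    ring
  have key : -t * ρ ≤ B * ρ + ∑ n ∈ Finset.range N, 2 * B * densityGap B (n + 1) ρ +
      3 * (c * ∑ m ∈ Finset.range N, max (-((2 * (m : ℝ) + 1) * B + t)) 0) := by
    have h := mul_le_mul_of_nonneg_left hN (by positivity : 0 ≤ c * B)
    simp_rw [← hgap, ← hlev]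
    rw [← Finset.mul_sum, ← Finset.mul_sum, ← Finset.mul_sum]
    have e1 : c * B * (-t / B * (ρ / c)) = -t * ρ := by field_simp
    have e2 : c * B * (ρ / c + 2 * sqrtGapSum N (ρ / c) +
        3 * ∑ m ∈ Finset.range N, max (-t / B - (2 * (m : ℝ) + 1)) 0) = B * ρ +
        2 * B * (c * sqrtGapSum N (ρ / c)) +
        3 * (c * (B * ∑ m ∈ Finset.range N, max (-t / B - (2 * (m : ℝ) + 1)) 0)) := by
      field_simp
    rw [e1, e2] at h
    exact h
  have hg0 : ∀ n : ℕ, 0 ≤ 2 * B * densityGap B (n + 1) ρ := fun n => by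
    have := densityGap_nonneg B (n + 1) ρ
    positivity
  refine (ENNReal.ofReal_le_ofReal key).trans ?_
  refine ENNReal.ofReal_add_le.trans (add_le_add (ENNReal.ofReal_add_le.trans ?_) ?_)
  · refine add_le_add le_rfl ?_
    rw [ENNReal.ofReal_sum_of_nonneg fun n _ => hg0 n]
    exact ENNReal.sum_le_tsum _
  · rw [ENNReal.ofReal_mul (by norm_num), ENNReal.ofReal_mul hc0.le, ENNReal.ofReal_ofNat,
      ENNReal.ofReal_sum_of_nonneg fun n _ => le_max_right _ _]
    gcongr
    exact ENNReal.sum_le_tsum _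

/-- The bound of `kinetic_energy_le` is uniform in the number `N` of levels, so it passes to the
supremum of the partial sums. -/
theorem lintegral_kinetic_le {ι : Type*} [Fintype ι] {B : ℝ} (hB : 0 < B)
    {ψ g₀ g₁ : ι → L2Plane} (hψ : IsBesselFamily ψ)
    (h₀ : ∀ i, IsWeakMagDeriv B 0 (ψ i) (g₀ i)) (h₁ : ∀ i, IsWeakMagDeriv B 1 (ψ i) (g₁ i)) :
    ∫⁻ x, (ENNReal.ofReal (B * density ψ x) +
      ∑' n : ℕ, ENNReal.ofReal (2 * B * densityGap B (n + 1) (density ψ x))) ≤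
      ENNReal.ofReal (∑ i, (‖g₀ i‖ ^ 2 + ‖g₁ i‖ ^ 2)) := by
  have hI := integrable_density ψ
  have hG := fun n => integrable_densityGap B (n + 1) ψ
  have hG0 : ∀ n x, 0 ≤ 2 * B * densityGap B (n + 1) (density ψ x) := fun n x => by
    have := densityGap_nonneg B (n + 1) (density ψ x)
    positivity
  have hI0 : ∀ x, 0 ≤ B * density ψ x := fun x => mul_nonneg hB.le (density_nonneg ψ x)
  have m1 : AEMeasurable (fun x => ENNReal.ofReal (B * density ψ x)) volume :=
    (hI.const_mul B).aemeasurable.ennreal_ofReal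
  have m2 : ∀ n : ℕ, AEMeasurable (fun x => ENNReal.ofReal (2 * B * densityGap B (n + 1)
      (density ψ x))) volume := fun n => ((hG n).const_mul (2 * B)).aemeasurable.ennreal_ofReal
  rw [lintegral_add_left' m1, lintegral_tsum m2, ENNReal.tsum_eq_iSup_nat, ENNReal.add_iSup]
  refine iSup_le fun N => ?_
  rw [← ofReal_integral_eq_lintegral_ofReal (hI.const_mul B) (Filter.Eventually.of_forall hI0)]
  simp_rw [fun n => (ofReal_integral_eq_lintegral_ofReal ((hG n).const_mul (2 * B))
    (Filter.Eventually.of_forall (hG0 n))).symm]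
  rw [← ENNReal.ofReal_sum_of_nonneg fun n _ => integral_nonneg (hG0 n), ← ENNReal.ofReal_add
    (integral_nonneg hI0) (Finset.sum_nonneg fun n _ => integral_nonneg (hG0 n))]
  refine ENNReal.ofReal_le_ofReal ?_
  simp_rw [integral_const_mul]
  rw [← Finset.mul_sum]
  exact kinetic_energy_le hB hψ h₀ h₁ N

/-- **Lieb–Thirring inequality** for Bessel families. -/
theorem lintegral_neg_potential_le {ι : Type*} [Fintype ι] {B : ℝ} (hB : 0 < B)
    {ψ g₀ g₁ : ι → L2Plane} (hψ : IsBesselFamily ψ)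
    (h₀ : ∀ i, IsWeakMagDeriv B 0 (ψ i) (g₀ i)) (h₁ : ∀ i, IsWeakMagDeriv B 1 (ψ i) (g₁ i))
    {V : Plane → ℝ} (hV : AEMeasurable V volume) :
    ∫⁻ x, ENNReal.ofReal (-V x * density ψ x) ≤
      ENNReal.ofReal (∑ i, (‖g₀ i‖ ^ 2 + ‖g₁ i‖ ^ 2)) +
      3 * (ENNReal.ofReal (B / (2 * Real.pi)) * ∫⁻ x, levelSum B (V x)) := by
  have hm : AEMeasurable (fun x => levelSum B (V x)) volume :=
    (measurable_levelSum B).comp_aemeasurable hV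
  calc _ ≤ ∫⁻ x, ((ENNReal.ofReal (B * density ψ x) +
        ∑' n : ℕ, ENNReal.ofReal (2 * B * densityGap B (n + 1) (density ψ x))) +
        3 * (ENNReal.ofReal (B / (2 * Real.pi)) * levelSum B (V x))) :=
      lintegral_mono fun x => ofReal_neg_mul_le hB (V x) (density_nonneg ψ x)
    _ = _ := lintegral_add_right' _ ((hm.const_mul _).const_mul _)
    _ ≤ _ := by
      rw [lintegral_const_mul'' _ (hm.const_mul _), lintegral_const_mul'' _ hm]
      gcongr
      exact lintegral_kinetic_le hB hψ h₀ h₁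

/-! ### Weak derivatives as a closed relation -/

theorem memLp_of_hasCompactSupport {φ : Plane → ℂ} (hφ : Continuous φ) (hc : HasCompactSupport φ) :
    MemLp φ 2 volume :=
  hφ.memLp_of_hasCompactSupport hc

theorem hasCompactSupport_magDeriv (B : ℝ) (j : Fin 2) {φ : Plane → ℂ} (hc : HasCompactSupport φ) :
    HasCompactSupport (magDeriv B j φ) :=
  ((hc.fderiv_apply (𝕜 := ℝ) _).mul_left).add hc.mul_left

theorem inner_toLp {φ : Plane → ℂ} (hφ : MemLp φ 2 volume) (u : L2Plane) :
    inner ℂ (hφ.toLp φ) u = ∫ x, conj (φ x) * u x := by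
  rw [inner_eq_integral]
  refine integral_congr_ae ?_
  filter_upwards [hφ.coeFn_toLp] with x hx
  rw [hx]

/-- Written as equalities of inner products with fixed `L²` vectors, the relation is visibly linear
and closed. -/
theorem isWeakMagDeriv_iff (B : ℝ) (j : Fin 2) (u g : L2Plane) :
    IsWeakMagDeriv B j u g ↔ ∀ (φ : Plane → ℂ) (h : ContDiff ℝ ∞ φ) (hc : HasCompactSupport φ),
      inner ℂ ((memLp_of_hasCompactSupport (continuous_magDeriv B j h)
        (hasCompactSupport_magDeriv B j hc)).toLp) u =
      inner ℂ ((memLp_of_hasCompactSupport h.continuous hc).toLp) g := by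
  simp_rw [inner_toLp]
  rfl

theorem IsWeakMagDeriv.add {B : ℝ} {j : Fin 2} {u g u' g' : L2Plane} (h : IsWeakMagDeriv B j u g)
    (h' : IsWeakMagDeriv B j u' g') : IsWeakMagDeriv B j (u + u') (g + g') := by
  rw [isWeakMagDeriv_iff] at *
  intro φ h1 h2
  rw [inner_add_right, inner_add_right, h φ h1 h2, h' φ h1 h2]

theorem IsWeakMagDeriv.smul {B : ℝ} {j : Fin 2} {u g : L2Plane} (a : ℂ)
    (h : IsWeakMagDeriv B j u g) : IsWeakMagDeriv B j (a • u) (a • g) := by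
  rw [isWeakMagDeriv_iff] at *
  intro φ h1 h2
  rw [inner_smul_right, inner_smul_right, h φ h1 h2]

theorem isClosed_isWeakMagDeriv (B : ℝ) (j : Fin 2) :
    IsClosed {p : L2Plane × L2Plane | IsWeakMagDeriv B j p.1 p.2} := by
  simp_rw [isWeakMagDeriv_iff, Set.ofPred_forall]
  refine isClosed_iInter fun φ => isClosed_iInter fun h1 => isClosed_iInter fun h2 => ?_
  exact isClosed_eq (by fun_prop) (by fun_prop)

theorem IsWeakMagDeriv.unique {B : ℝ} {j : Fin 2} {u g g' : L2Plane} (h : IsWeakMagDeriv B j u g)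
    (h' : IsWeakMagDeriv B j u g') : g = g' := by
  rw [← sub_eq_zero, Lp.eq_zero_iff_ae_eq_zero]
  refine ae_eq_zero_of_integral_contDiff_smul_eq_zero
    ((Lp.memLp (g - g')).locallyIntegrable (by norm_num)) fun φ hφ hc => ?_
  have hg₁ : HasCompactSupport (Complex.ofRealCLM ∘ φ) := hc.comp_left rfl
  have hg₂ : ContDiff ℝ ∞ (Complex.ofRealCLM ∘ φ) := by fun_prop
  rw [isWeakMagDeriv_iff] at *
  have h1 : inner ℂ ((memLp_of_hasCompactSupport hg₂.continuous hg₁).toLp) (g - g') = 0 := by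
    rw [inner_sub_right, ← h _ hg₂ hg₁, ← h' _ hg₂ hg₁, sub_self]
  rw [inner_toLp] at h1
  simpa using h1

theorem IsWeakMagDeriv.weakMagDeriv_eq {B : ℝ} {j : Fin 2} {u g : L2Plane}
    (h : IsWeakMagDeriv B j u g) : weakMagDeriv B j u = g := by
  have he : ∃ g, IsWeakMagDeriv B j u g := ⟨g, h⟩
  rw [weakMagDeriv, dif_pos he]
  exact he.choose_spec.unique h

theorem isWeakMagDeriv_weakMagDeriv {B : ℝ} {j : Fin 2} {u : L2Plane}
    (h : ∃ g, IsWeakMagDeriv B j u g) : IsWeakMagDeriv B j u (weakMagDeriv B j u) := by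
  obtain ⟨g, hg⟩ := h
  rwa [hg.weakMagDeriv_eq]

/-! ### The form bound for the negative part of the potential -/

theorem isBesselFamily_of_norm_le_one {H : Type*} [NormedAddCommGroup H] [InnerProductSpace ℂ H]
    {w : H} (hw : ‖w‖ ≤ 1) : IsBesselFamily fun _ : Unit => w := by
  intro f
  simp only [Finset.univ_unique, Finset.sum_const, Finset.card_singleton, one_smul]
  have := norm_inner_le_norm (𝕜 := ℂ) w f
  have h2 : ‖w‖ * ‖f‖ ≤ ‖f‖ := mul_le_of_le_one_left (norm_nonneg _) hw
  exact pow_le_pow_left₀ (norm_nonneg _) (this.trans h2) 2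

theorem integrable_negPart_mul {V : Plane → ℝ} {u : L2Plane}
    (h : Integrable (fun x => V x * ‖u x‖ ^ 2) volume) :
    Integrable (fun x => max (-V x) 0 * ‖u x‖ ^ 2) volume := by
  refine h.neg.pos_part.congr (Filter.Eventually.of_forall fun x => ?_)
  simp only [Pi.neg_apply]
  rw [max_mul_of_nonneg _ _ (by positivity), zero_mul, neg_mul]

theorem integrable_posPart_mul {V : Plane → ℝ} {u : L2Plane}
    (h : Integrable (fun x => V x * ‖u x‖ ^ 2) volume) :
    Integrable (fun x => max (V x) 0 * ‖u x‖ ^ 2) volume := by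
  refine h.pos_part.congr (Filter.Eventually.of_forall fun x => ?_)
  simp only
  rw [max_mul_of_nonneg _ _ (by positivity), zero_mul]

/-- The constant in the form bound for the negative part of the potential. -/
noncomputable def formBoundConst (B : ℝ) (V : Plane → ℝ) : ℝ :=
  B + 12 * (B / (2 * Real.pi)) * (∫⁻ x, levelSum B (V x)).toReal

theorem formBoundConst_nonneg {B : ℝ} (hB : 0 ≤ B) (V : Plane → ℝ) : 0 ≤ formBoundConst B V := by
  have := Real.pi_pos
  unfold formBoundConst
  positivity

/-- The Lieb–Thirring bound is applied to `2V + B`. Doubling provides the relative bound 1/2; the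
shift by `B` is needed because the expression for `2V` alone may be infinite, as for `V = -3B/4`.
The level sum of `2V + B` costs a factor 4, whence `12 = 3 * 4`, and undoing the shift costs the `B`
in `formBoundConst`. -/
theorem form_bound_of_norm_eq_one {B : ℝ} (hB : 0 < B) {V : Plane → ℝ} (hV : AEMeasurable V volume)
    (hfin : ∫⁻ x, levelSum B (V x) ≠ ⊤) {u g₀ g₁ : L2Plane} (hu : ‖u‖ = 1)
    (h₀ : IsWeakMagDeriv B 0 u g₀) (h₁ : IsWeakMagDeriv B 1 u g₁)
    (hI : Integrable (fun x => max (-V x) 0 * ‖u x‖ ^ 2) volume) :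
    2 * ∫ x, max (-V x) 0 * ‖u x‖ ^ 2 ≤ ‖g₀‖ ^ 2 + ‖g₁‖ ^ 2 + formBoundConst B V := by
  have hpi := Real.pi_pos
  set c := B / (2 * Real.pi) with hc
  set S := ∫⁻ x, levelSum B (V x) with hS
  have hW : AEMeasurable (fun x => 2 * V x + B) volume := by fun_prop
  have h := lintegral_neg_potential_le hB (isBesselFamily_of_norm_le_one hu.le)
    (fun _ => h₀) (fun _ => h₁) hW
  have hlev : ∫⁻ x, levelSum B (2 * V x + B) ≤ 4 * S := by
    have hm : AEMeasurable (fun x => levelSum B (V x)) volume :=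
      (measurable_levelSum B).comp_aemeasurable hV
    rw [hS, ← lintegral_const_mul'' _ hm]
    exact lintegral_mono fun x => levelSum_two_mul_add_le hB.le (V x)
  have hd : ∀ x, density (fun _ : Unit => u) x = ‖u x‖ ^ 2 := fun x => by simp [density]
  simp_rw [hd] at h
  simp only [Finset.univ_unique, Finset.sum_const, Finset.card_singleton, one_smul] at h
  have hX : Integrable (fun x => max (-(2 * V x + B)) 0 * ‖u x‖ ^ 2) volume := by
    refine (hI.const_mul 2).mono' ?_ (Filter.Eventually.of_forall fun x => ?_)
    · have h1 : AEMeasurable (fun x => ‖u x‖ ^ 2) volume := (integrable_norm_sq u).aemeasurable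
      exact AEMeasurable.aestronglyMeasurable (by fun_prop)
    · rw [Real.norm_of_nonneg (by positivity), ← mul_assoc]
      gcongr
      rw [mul_max_of_nonneg _ _ (by norm_num : (0 : ℝ) ≤ 2)]
      exact max_le_max (by linarith) (by norm_num)
  have hX' : ENNReal.ofReal (∫ x, max (-(2 * V x + B)) 0 * ‖u x‖ ^ 2) =
      ∫⁻ x, ENNReal.ofReal (-(2 * V x + B) * ‖u x‖ ^ 2) := by
    rw [ofReal_integral_eq_lintegral_ofReal hX (Filter.Eventually.of_forall fun x => by
      simp only [Pi.zero_apply]; positivity)]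
    refine lintegral_congr fun x => ?_
    rw [max_mul_of_nonneg _ _ (by positivity), zero_mul]
    rcases le_total 0 (-(2 * V x + B) * ‖u x‖ ^ 2) with h0 | h0
    · rw [max_eq_left h0]
    · rw [max_eq_right h0, ENNReal.ofReal_zero, ENNReal.ofReal_of_nonpos h0]
  have h2 : ENNReal.ofReal (∫ x, max (-(2 * V x + B)) 0 * ‖u x‖ ^ 2) ≤
      ENNReal.ofReal (‖g₀‖ ^ 2 + ‖g₁‖ ^ 2 + 12 * c * S.toReal) := by
    rw [hX']
    refine h.trans ?_
    rw [ENNReal.ofReal_add (p := ‖g₀‖ ^ 2 + ‖g₁‖ ^ 2) (q := 12 * c * S.toReal) (by positivity)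
      (by positivity)]
    refine add_le_add le_rfl ?_
    calc 3 * (ENNReal.ofReal c * ∫⁻ x, levelSum B (2 * V x + B))
        ≤ 3 * (ENNReal.ofReal c * (4 * S)) := by gcongr
      _ = 12 * ENNReal.ofReal c * S := by ring
      _ = ENNReal.ofReal (12 * c * S.toReal) := by
        rw [ENNReal.ofReal_mul (by positivity), ENNReal.ofReal_mul (by positivity),
          ENNReal.ofReal_toReal hfin, ENNReal.ofReal_ofNat]
  rw [ENNReal.ofReal_le_ofReal_iff (by positivity)] at h2
  have h3 : 2 * ∫ x, max (-V x) 0 * ‖u x‖ ^ 2 ≤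
      (∫ x, max (-(2 * V x + B)) 0 * ‖u x‖ ^ 2) + B * ∫ x, ‖u x‖ ^ 2 := by
    rw [← integral_const_mul, ← integral_const_mul, ← integral_add hX
      ((integrable_norm_sq u).const_mul B)]
    refine integral_mono (hI.const_mul 2) (hX.add ((integrable_norm_sq u).const_mul B)) fun x => ?_
    simp only
    rw [← mul_assoc, ← add_mul]
    gcongr
    rw [mul_max_of_nonneg _ _ (by norm_num : (0 : ℝ) ≤ 2)]
    refine max_le ?_ ?_
    · linarith [le_max_left (-(2 * V x + B)) 0]
    · linarith [le_max_right (-(2 * V x + B)) 0]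
  rw [← norm_sq_eq_integral, hu] at h3
  rw [formBoundConst]
  linarith

/-- Obtained by scaling from norm one: the Lieb–Thirring bound for a single vector is not
homogeneous, because its error term does not scale with the vector. -/
theorem form_bound {B : ℝ} (hB : 0 < B) {V : Plane → ℝ} (hV : AEMeasurable V volume)
    (hfin : ∫⁻ x, levelSum B (V x) ≠ ⊤) {u g₀ g₁ : L2Plane}
    (h₀ : IsWeakMagDeriv B 0 u g₀) (h₁ : IsWeakMagDeriv B 1 u g₁)
    (hI : Integrable (fun x => max (-V x) 0 * ‖u x‖ ^ 2) volume) :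
    2 * ∫ x, max (-V x) 0 * ‖u x‖ ^ 2 ≤
      ‖g₀‖ ^ 2 + ‖g₁‖ ^ 2 + formBoundConst B V * ‖u‖ ^ 2 := by
  by_cases hu : u = 0
  · have h1 : ∫ x, max (-V x) 0 * ‖u x‖ ^ 2 = 0 := by
      rw [integral_eq_zero_of_ae]
      filter_upwards [(Lp.eq_zero_iff_ae_eq_zero (f := u)).1 hu] with x hx
      simp [hx]
    rw [h1, hu, norm_zero, mul_zero, zero_pow two_ne_zero, mul_zero]
    positivity
  have hu0 : 0 < ‖u‖ := norm_pos_iff.2 hu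
  set a : ℂ := ((‖u‖⁻¹ : ℝ) : ℂ) with ha
  have han : ‖a‖ = ‖u‖⁻¹ := by rw [ha, Complex.norm_real, Real.norm_of_nonneg (by positivity)]
  have he : ∀ᵐ x, max (-V x) 0 * ‖(a • u : L2Plane) x‖ ^ 2 =
      (‖u‖⁻¹) ^ 2 * (max (-V x) 0 * ‖u x‖ ^ 2) := by
    filter_upwards [Lp.coeFn_smul a u] with x hx
    rw [hx, Pi.smul_apply, norm_smul, han]
    ring
  have hn : ‖a • u‖ = 1 := by rw [norm_smul, han, inv_mul_cancel₀ hu0.ne']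
  have h := form_bound_of_norm_eq_one hB hV hfin hn (h₀.smul a) (h₁.smul a)
    ((hI.const_mul _).congr (he.mono fun x hx => hx.symm))
  rw [integral_congr_ae he, integral_const_mul, norm_smul, norm_smul, han] at h
  have h2 := mul_le_mul_of_nonneg_left h (by positivity : 0 ≤ ‖u‖ ^ 2)
  have e1 : ‖u‖ ^ 2 * (2 * (‖u‖⁻¹ ^ 2 * ∫ x, max (-V x) 0 * ‖u x‖ ^ 2)) =
      2 * ∫ x, max (-V x) 0 * ‖u x‖ ^ 2 := by
    field_simp
  have e2 : ‖u‖ ^ 2 * ((‖u‖⁻¹ * ‖g₀‖) ^ 2 + (‖u‖⁻¹ * ‖g₁‖) ^ 2 + formBoundConst B V) =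
      ‖g₀‖ ^ 2 + ‖g₁‖ ^ 2 + formBoundConst B V * ‖u‖ ^ 2 := by
    field_simp
  rwa [e1, e2] at h2

/-! ### The form domain as a Hilbert space -/

/-- `h` is the product of `u` and the real function `m`. -/
def IsMulBy (m : Plane → ℝ) (u h : L2Plane) : Prop := ∀ᵐ x, h x = m x * u x

theorem IsMulBy.add {m : Plane → ℝ} {u h u' h' : L2Plane} (H : IsMulBy m u h)
    (H' : IsMulBy m u' h') : IsMulBy m (u + u') (h + h') := by
  unfold IsMulBy at *
  filter_upwards [H, H', Lp.coeFn_add u u', Lp.coeFn_add h h'] with x h1 h2 h3 h4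
  rw [h3, h4, Pi.add_apply, Pi.add_apply, h1, h2, mul_add]

theorem IsMulBy.smul {m : Plane → ℝ} {u h : L2Plane} (a : ℂ) (H : IsMulBy m u h) :
    IsMulBy m (a • u) (a • h) := by
  unfold IsMulBy at *
  filter_upwards [H, Lp.coeFn_smul a u, Lp.coeFn_smul a h] with x h1 h3 h4
  rw [h3, h4, Pi.smul_apply, Pi.smul_apply, h1, smul_eq_mul, smul_eq_mul]
  ring

theorem isMulBy_zero (m : Plane → ℝ) : IsMulBy m 0 0 := by
  unfold IsMulBy
  filter_upwards [Lp.coeFn_zero ℂ 2 (volume : Measure Plane)] with x hx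
  rw [hx]
  simp

/-- The multiplier may be unbounded, so the limit is taken pointwise, along a subsequence on which
both components converge almost everywhere. -/
theorem isClosed_isMulBy (m : Plane → ℝ) :
    IsClosed {p : L2Plane × L2Plane | IsMulBy m p.1 p.2} := by
  refine IsSeqClosed.isClosed fun p q hp hq => ?_
  have h1 : Filter.Tendsto (fun n => (p n).1) Filter.atTop (nhds q.1) :=
    (continuous_fst.tendsto q).comp hq
  obtain ⟨ns, hns, hae⟩ := (tendstoInMeasure_of_tendsto_Lp h1).exists_seq_tendsto_ae
  have h2 : Filter.Tendsto (fun n => (p (ns n)).2) Filter.atTop (nhds q.2) :=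
    ((continuous_snd.tendsto q).comp hq).comp hns.tendsto_atTop
  obtain ⟨ns', hns', hae'⟩ := (tendstoInMeasure_of_tendsto_Lp h2).exists_seq_tendsto_ae
  have hall : ∀ᵐ x, ∀ n, (p n).2 x = m x * (p n).1 x := ae_all_iff.2 hp
  change ∀ᵐ x, q.2 x = m x * q.1 x
  filter_upwards [hae, hae', hall] with x t1 t2 he
  refine tendsto_nhds_unique t2 ?_
  simp_rw [he]
  exact (t1.comp hns'.tendsto_atTop).const_mul _

/-- The form domain as a space of tuples `(u, D₁ u, D₂ u, √V₊ u, √V₋ u)`. -/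
noncomputable def formSpace (B : ℝ) (V : Plane → ℝ) :
    Submodule ℂ (PiLp 2 fun _ : Fin 5 => L2Plane) where
  carrier := {p | IsWeakMagDeriv B 0 (p 0) (p 1) ∧ IsWeakMagDeriv B 1 (p 0) (p 2) ∧
    IsMulBy (fun x => √(max (V x) 0)) (p 0) (p 3) ∧ IsMulBy (fun x => √(max (-V x) 0)) (p 0) (p 4)}
  add_mem' := fun hp hq => ⟨hp.1.add hq.1, hp.2.1.add hq.2.1, hp.2.2.1.add hq.2.2.1,
    hp.2.2.2.add hq.2.2.2⟩
  zero_mem' := by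
    have h : ∀ j, IsWeakMagDeriv B j 0 0 := fun j => by
      rw [isWeakMagDeriv_iff]
      intro φ h1 h2
      rw [inner_zero_right, inner_zero_right]
    exact ⟨h 0, h 1, isMulBy_zero _, isMulBy_zero _⟩
  smul_mem' := fun a _ hp => ⟨hp.1.smul a, hp.2.1.smul a, hp.2.2.1.smul a, hp.2.2.2.smul a⟩

theorem isClosed_formSpace (B : ℝ) (V : Plane → ℝ) :
    IsClosed (formSpace B V : Set (PiLp 2 fun _ : Fin 5 => L2Plane)) := by
  have hc : ∀ i j : Fin 5, Continuous fun p : PiLp 2 fun _ : Fin 5 => L2Plane => (p i, p j) :=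
    fun i j => by fun_prop
  exact ((isClosed_isWeakMagDeriv B 0).preimage (hc 0 1)).inter
    (((isClosed_isWeakMagDeriv B 1).preimage (hc 0 2)).inter
      (((isClosed_isMulBy _).preimage (hc 0 3)).inter ((isClosed_isMulBy _).preimage (hc 0 4))))

instance completeSpace_formSpace (B : ℝ) (V : Plane → ℝ) : CompleteSpace (formSpace B V) :=
  (isClosed_formSpace B V).completeSpace_coe

theorem IsMulBy.norm_sq_eq {m : Plane → ℝ} (hm : ∀ x, 0 ≤ m x) {u h : L2Plane}
    (H : IsMulBy (fun x => √(m x)) u h) :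
    Integrable (fun x => m x * ‖u x‖ ^ 2) volume ∧ ‖h‖ ^ 2 = ∫ x, m x * ‖u x‖ ^ 2 := by
  have e : ∀ᵐ x, ‖h x‖ ^ 2 = m x * ‖u x‖ ^ 2 := by
    filter_upwards [H] with x hx
    rw [hx, norm_mul, mul_pow, Complex.norm_real, Real.norm_eq_abs, sq_abs, Real.sq_sqrt (hm x)]
  exact ⟨(integrable_norm_sq h).congr e, by rw [norm_sq_eq_integral, integral_congr_ae e]⟩

theorem exists_isMulBy_sqrt {m : Plane → ℝ} (hm : ∀ x, 0 ≤ m x) (hmm : AEMeasurable m volume)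
    {u : L2Plane} (h : Integrable (fun x => m x * ‖u x‖ ^ 2) volume) :
    ∃ h, IsMulBy (fun x => √(m x)) u h := by
  have hmeas : AEStronglyMeasurable (fun x => (√(m x) : ℂ) * u x) volume := by
    refine AEStronglyMeasurable.mul ?_ (Lp.aestronglyMeasurable u)
    exact (Complex.measurable_ofReal.comp_aemeasurable
      (Real.continuous_sqrt.measurable.comp_aemeasurable hmm)).aestronglyMeasurable
  have hL : MemLp (fun x => (√(m x) : ℂ) * u x) 2 volume := by
    rw [memLp_two_iff_integrable_sq_norm hmeas]
    refine h.congr (Filter.Eventually.of_forall fun x => ?_)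
    simp only
    rw [norm_mul, mul_pow, Complex.norm_real, Real.norm_eq_abs, sq_abs, Real.sq_sqrt (hm x)]
  exact ⟨hL.toLp, hL.coeFn_toLp⟩

theorem mem_formDomain_iff {B : ℝ} {V : Plane → ℝ} (hV : AEMeasurable V volume) {u : L2Plane} :
    u ∈ formDomain B V ↔ ∃ p ∈ formSpace B V, p 0 = u := by
  constructor
  · rintro ⟨hd, hI⟩
    obtain ⟨g₀, h₀⟩ := hd 0
    obtain ⟨g₁, h₁⟩ := hd 1
    obtain ⟨w₃, h₃⟩ := exists_isMulBy_sqrt (fun x => le_max_right (V x) 0) (by fun_prop)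
      (integrable_posPart_mul hI)
    obtain ⟨w₄, h₄⟩ := exists_isMulBy_sqrt (fun x => le_max_right (-V x) 0) (by fun_prop)
      (integrable_negPart_mul hI)
    exact ⟨WithLp.toLp 2 ![u, g₀, g₁, w₃, w₄], ⟨h₀, h₁, h₃, h₄⟩, rfl⟩
  · rintro ⟨p, ⟨h₀, h₁, h₃, h₄⟩, rfl⟩
    refine ⟨fun j => ?_, ?_⟩
    · fin_cases j
      exacts [⟨_, h₀⟩, ⟨_, h₁⟩]
    · have i1 := (h₃.norm_sq_eq fun x => le_max_right (V x) 0).1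
      have i2 := (h₄.norm_sq_eq fun x => le_max_right (-V x) 0).1
      refine (i1.sub i2).congr (Filter.Eventually.of_forall fun x => ?_)
      simp only [Pi.sub_apply]
      rw [← sub_mul]
      congr 1
      rcases le_total 0 (V x) with h | h
      · rw [max_eq_left h, max_eq_right (by linarith)]; ring
      · rw [max_eq_right h, max_eq_left (by linarith)]; ring

theorem landauForm_eq {B : ℝ} {V : Plane → ℝ} {p q : PiLp 2 fun _ : Fin 5 => L2Plane}
    (hp : p ∈ formSpace B V) (hq : q ∈ formSpace B V) :
    landauForm B V (q 0) (p 0) = inner ℂ (q 1) (p 1) + inner ℂ (q 2) (p 2) +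
      inner ℂ (q 3) (p 3) - inner ℂ (q 4) (p 4) := by
  have e : ∫ x, (V x : ℂ) * (conj (q 0 x) * p 0 x) =
      inner ℂ (q 3) (p 3) - inner ℂ (q 4) (p 4) := by
    rw [inner_eq_integral, inner_eq_integral, ← integral_sub
      (integrable_conj_mul (Lp.memLp _) (Lp.memLp _))
      (integrable_conj_mul (Lp.memLp _) (Lp.memLp _))]
    refine integral_congr_ae ?_
    filter_upwards [hp.2.2.1, hp.2.2.2, hq.2.2.1, hq.2.2.2] with x h1 h2 h3 h4
    rw [h1, h2, h3, h4]
    simp only [map_mul, Complex.conj_ofReal]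
    have h5 : (√(max (V x) 0) : ℂ) * √(max (V x) 0) = (max (V x) 0 : ℝ) := by
      rw [← Complex.ofReal_mul, Real.mul_self_sqrt (le_max_right _ _)]
    have h6 : (√(max (-V x) 0) : ℂ) * √(max (-V x) 0) = (max (-V x) 0 : ℝ) := by
      rw [← Complex.ofReal_mul, Real.mul_self_sqrt (le_max_right _ _)]
    have h7 : (V x : ℂ) = (max (V x) 0 : ℝ) - (max (-V x) 0 : ℝ) := by
      rw [← Complex.ofReal_sub]
      congr 1
      rcases le_total 0 (V x) with h | h
      · rw [max_eq_left h, max_eq_right (by linarith)]; ring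
      · rw [max_eq_right h, max_eq_left (by linarith)]; ring
    rw [h7, ← h5, ← h6]
    ring
  rw [landauForm, Fin.sum_univ_two, e, hp.1.weakMagDeriv_eq, hq.1.weakMagDeriv_eq,
    hp.2.1.weakMagDeriv_eq, hq.2.1.weakMagDeriv_eq]
  ring

/-! ### The operator of the form and its resolvent -/

/-- The components of an element of `formSpace B V`. -/
noncomputable def formProj (B : ℝ) (V : Plane → ℝ) (i : Fin 5) : formSpace B V →L[ℂ] L2Plane :=
  (PiLp.proj 2 (fun _ : Fin 5 => L2Plane) i) ∘L (formSpace B V).subtypeL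

theorem formProj_apply {B : ℝ} {V : Plane → ℝ} (i : Fin 5) (p : formSpace B V) :
    formProj B V i p = p.1 i := rfl

/-- The bounded operator on `formSpace B V` which represents the form of `H_B + V + c`. -/
noncomputable def formOp (B : ℝ) (V : Plane → ℝ) (c : ℝ) : formSpace B V →L[ℂ] formSpace B V :=
  ∑ i, ((![c, 1, 1, 1, -1] i : ℝ) : ℂ) •
    (ContinuousLinearMap.adjoint (formProj B V i) ∘L formProj B V i)

theorem inner_formOp {B : ℝ} {V : Plane → ℝ} (c : ℝ) (q p : formSpace B V) :
    inner ℂ q (formOp B V c p) = landauForm B V (q.1 0) (p.1 0) + c * inner ℂ (q.1 0) (p.1 0) := by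
  have h : ∀ (a : ℂ) (i : Fin 5), inner ℂ q ((a • (ContinuousLinearMap.adjoint (formProj B V i) ∘L
      formProj B V i)) p) = a * inner ℂ (q.1 i) (p.1 i) := by
    intro a i
    rw [← formProj_apply, ← formProj_apply, ← ContinuousLinearMap.adjoint_inner_right]
    exact inner_smul_right (𝕜 := ℂ) (E := formSpace B V) q _ a
  rw [formOp, landauForm_eq p.2 q.2, sum_apply, inner_sum]
  simp only [h, Fin.sum_univ_five, Matrix.cons_val]
  push_cast
  ring

theorem inner_formOp_self {B : ℝ} {V : Plane → ℝ} (c : ℝ) (p : formSpace B V) :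
    inner ℂ p (formOp B V c p) = ((c * ‖p.1 0‖ ^ 2 + ‖p.1 1‖ ^ 2 + ‖p.1 2‖ ^ 2 + ‖p.1 3‖ ^ 2 -
      ‖p.1 4‖ ^ 2 : ℝ) : ℂ) := by
  rw [inner_formOp, landauForm_eq p.2 p.2]
  simp only [inner_self_eq_norm_sq_to_K]
  push_cast
  simp only [Complex.coe_algebraMap]
  ring

/-- Coercivity with respect to the full norm, including the component `√V₋ u` that enters the form
with a minus sign. The form bound absorbs `5/4` of that component at the cost of `5/8` of the
kinetic terms, and `3/4` is available. -/
theorem norm_sq_le_formOp {B : ℝ} (hB : 0 < B) {V : Plane → ℝ} (hV : AEMeasurable V volume)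
    (hfin : ∫⁻ x, levelSum B (V x) ≠ ⊤) (p : formSpace B V) :
    ‖p‖ ^ 2 * (1 / 4) ≤ (formBoundConst B V + 1) * ‖p.1 0‖ ^ 2 + ‖p.1 1‖ ^ 2 + ‖p.1 2‖ ^ 2 +
      ‖p.1 3‖ ^ 2 - ‖p.1 4‖ ^ 2 := by
  obtain ⟨h₀, h₁, h₃, h₄⟩ := p.2
  obtain ⟨i4, e4⟩ := h₄.norm_sq_eq fun x => le_max_right (-V x) 0
  have h := form_bound hB hV hfin h₀ h₁ i4
  rw [← e4] at h
  have hC := formBoundConst_nonneg hB.le V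
  have hn : ‖p‖ ^ 2 = ∑ i, ‖p.1 i‖ ^ 2 := PiLp.norm_sq_eq_of_L2 _ p.1
  rw [Fin.sum_univ_five] at hn
  rw [hn]
  nlinarith [sq_nonneg ‖p.1 0‖, sq_nonneg ‖p.1 1‖, sq_nonneg ‖p.1 2‖, sq_nonneg ‖p.1 3‖,
    sq_nonneg ‖p.1 4‖, mul_nonneg hC (sq_nonneg ‖p.1 0‖)]

/-- If the semiclassical expression is finite, `H_B + V` is self-adjoint and bounded from below. -/
theorem exists_isShiftedInverse {B : ℝ} (hB : 0 < B) {V : Plane → ℝ} (hV : AEMeasurable V volume)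
    (hfin : ∫⁻ x, levelSum B (V x) ≠ ⊤) :
    ∃ (c : ℝ) (R : L2Plane →L[ℂ] L2Plane), IsShiftedInverse (landauGraph B V) c R := by
  set c := formBoundConst B V + 1 with hc
  set T := formOp B V c with hT
  have hunit : IsUnit T := by
    -- Lax–Milgram.
    refine ContinuousLinearMap.isUnit_of_forall_le_norm_inner_map T (c := 1 / 4) (by positivity)
      fun p => ?_
    rw [norm_inner_symm, inner_formOp_self, Complex.norm_real]
    refine le_trans ?_ (le_abs_self _)
    have := norm_sq_le_formOp hB hV hfin p
    push_cast
    exact this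
  obtain ⟨U, hU⟩ := hunit
  set T' : formSpace B V →L[ℂ] formSpace B V := ((U⁻¹ : (formSpace B V →L[ℂ] formSpace B V)ˣ) :
    formSpace B V →L[ℂ] formSpace B V) with hT'
  have hTT' : ∀ p, T (T' p) = p := fun p => by
    have : T * T' = 1 := by rw [← hU, hT', Units.mul_inv]
    exact congrArg (fun A : formSpace B V →L[ℂ] formSpace B V => A p) this
  have hT'T : ∀ p, T' (T p) = p := fun p => by
    have : T' * T = 1 := by rw [← hU, hT', Units.inv_mul]
    exact congrArg (fun A : formSpace B V →L[ℂ] formSpace B V => A p) this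
  set J := formProj B V 0 with hJ
  set J' := ContinuousLinearMap.adjoint J with hJ'
  -- `J` embeds the form domain in `L²`, so `J T⁻¹ J*` solves the weak equation for `H_B + V + c`.
  -- It vanishes on the orthogonal complement of the form domain, hence density is not required.
  refine ⟨c, J ∘L T' ∘L J', ?_, fun f u => ?_⟩
  · rw [ContinuousLinearMap.isPositive_iff_complex]
    intro f
    have h1 : inner ℂ ((J ∘L T' ∘L J') f) f = inner ℂ (T' (J' f)) (T (T' (J' f))) := by
      rw [hTT', ContinuousLinearMap.comp_apply, ContinuousLinearMap.comp_apply, hJ',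
        ContinuousLinearMap.adjoint_inner_right]
    rw [h1, inner_formOp_self]
    refine ⟨rfl, ?_⟩
    have := norm_sq_le_formOp hB hV hfin (T' (J' f))
    rw [RCLike.re_eq_complex_re, Complex.ofReal_re]
    exact le_trans (by positivity) this
  · constructor
    · rintro ⟨hu, hform⟩
      obtain ⟨p, hp, rfl⟩ := (mem_formDomain_iff hV).1 hu
      have h1 : T ⟨p, hp⟩ = J' f := by
        refine ext_inner_left ℂ fun q => ?_
        rw [inner_formOp, hJ', ContinuousLinearMap.adjoint_inner_right,
          hform _ ((mem_formDomain_iff hV).2 ⟨q.1, q.2, rfl⟩), inner_sub_right, inner_smul_right,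
          hJ, formProj_apply]
        ring
      rw [ContinuousLinearMap.comp_apply, ContinuousLinearMap.comp_apply, ← h1, hT'T]
      rfl
    · intro h
      set p := T' (J' f) with hp
      have hpu : p.1 0 = u := h
      refine ⟨(mem_formDomain_iff hV).2 ⟨p.1, p.2, hpu⟩, fun v hv => ?_⟩
      obtain ⟨q, hq, rfl⟩ := (mem_formDomain_iff hV).1 hv
      have h2 := inner_formOp c ⟨q, hq⟩ p
      rw [← hT, hp, hTT', hJ', ContinuousLinearMap.adjoint_inner_right, hJ, formProj_apply] at h2
      simp only [← hJ, ← hJ', ← hp, hpu] at h2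
      simp only
      rw [inner_sub_right, inner_smul_right, h2]
      ring

/-! ### The trace of the negative part -/

theorem re_landauForm_self (B : ℝ) (V : Plane → ℝ) (u : L2Plane) :
    (landauForm B V u u).re =
      ‖weakMagDeriv B 0 u‖ ^ 2 + ‖weakMagDeriv B 1 u‖ ^ 2 + ∫ x, V x * ‖u x‖ ^ 2 := by
  have e : ∀ x, (V x : ℂ) * (conj (u x) * u x) = ((V x * ‖u x‖ ^ 2 : ℝ) : ℂ) := by
    intro x
    rw [← Complex.normSq_eq_conj_mul_self, Complex.normSq_eq_norm_sq]
    push_cast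
    ring
  have h : ∀ w : L2Plane, (inner ℂ w w).re = ‖w‖ ^ 2 := fun w => inner_self_eq_norm_sq (𝕜 := ℂ) w
  rw [landauForm, Fin.sum_univ_two, Complex.add_re, Complex.add_re, h, h]
  simp_rw [e]
  rw [integral_complex_ofReal, Complex.ofReal_re]

/-- The variational form of the Lieb–Thirring inequality. -/
theorem neg_sum_landauForm_le {ι : Type*} [Fintype ι] {B : ℝ} (hB : 0 < B) {V : Plane → ℝ}
    (hV : AEMeasurable V volume) (hfin : ∫⁻ x, levelSum B (V x) ≠ ⊤) {ψ : ι → L2Plane}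
    (hψ : IsBesselFamily ψ) (hD : ∀ i, ψ i ∈ formDomain B V) :
    -∑ i, (landauForm B V (ψ i) (ψ i)).re ≤
      (3 * (ENNReal.ofReal (B / (2 * Real.pi)) * ∫⁻ x, levelSum B (V x))).toReal := by
  set X := 3 * (ENNReal.ofReal (B / (2 * Real.pi)) * ∫⁻ x, levelSum B (V x)) with hX
  have hXfin : X ≠ ⊤ :=
    ENNReal.mul_ne_top (by norm_num) (ENNReal.mul_ne_top ENNReal.ofReal_ne_top hfin)
  set E := ∑ i, (‖weakMagDeriv B 0 (ψ i)‖ ^ 2 + ‖weakMagDeriv B 1 (ψ i)‖ ^ 2) with hE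
  have hE0 : 0 ≤ E := Finset.sum_nonneg fun i _ => by positivity
  have h := lintegral_neg_potential_le hB hψ (fun i => isWeakMagDeriv_weakMagDeriv ((hD i).1 0))
    (fun i => isWeakMagDeriv_weakMagDeriv ((hD i).1 1)) hV
  have hI : Integrable (fun x => -V x * density ψ x) volume := by
    have : Integrable (fun x => ∑ i, -(V x * ‖ψ i x‖ ^ 2)) volume :=
      integrable_finsetSum _ fun i _ => (hD i).2.neg
    refine this.congr (Filter.Eventually.of_forall fun x => ?_)
    simp only [density, Finset.mul_sum, neg_mul]
  have e1 : ∫ x, -V x * density ψ x = -∑ i, ∫ x, V x * ‖ψ i x‖ ^ 2 := by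
    rw [← integral_finsetSum _ fun i _ => (hD i).2, ← integral_neg]
    congr 1
    ext x
    simp only [density, Finset.mul_sum, neg_mul, Finset.sum_neg_distrib]
  have h2 : ∫ x, -V x * density ψ x ≤ E + X.toReal := by
    -- The bound `h` controls the positive part of `-Vρ`; the part that is subtracted has the
    -- favourable sign.
    rw [integral_eq_lintegral_pos_part_sub_lintegral_neg_part hI]
    have h3 : (∫⁻ x, ENNReal.ofReal (-V x * density ψ x)).toReal ≤ E + X.toReal := by
      refine (ENNReal.toReal_mono (ENNReal.add_ne_top.2 ⟨ENNReal.ofReal_ne_top, hXfin⟩) h).trans ?_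
      rw [ENNReal.toReal_add ENNReal.ofReal_ne_top hXfin, ENNReal.toReal_ofReal hE0]
    have h4 : 0 ≤ (∫⁻ x, ENNReal.ofReal (-(-V x * density ψ x))).toReal := ENNReal.toReal_nonneg
    linarith
  simp_rw [re_landauForm_self]
  rw [Finset.sum_add_distrib]
  rw [e1] at h2
  linarith

/-! ### Functional calculus for the shifted inverse -/

section FunctionalCalculus

theorem re_inner_le_of_le {H : Type*} [NormedAddCommGroup H] [InnerProductSpace ℂ H]
    {S T : H →L[ℂ] H} (h : S ≤ T) (x : H) :
    (inner ℂ x (S x)).re ≤ (inner ℂ x (T x)).re := by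
  rw [ContinuousLinearMap.le_def] at h
  have := h.re_inner_nonneg_right x
  rw [sub_apply, inner_sub_right, map_sub] at this
  exact sub_nonneg.1 this

/-- The function defining the negative part, with a denominator that is bounded away from zero. -/
noncomputable def negPartFun (c t : ℝ) : ℝ := max (c * t - 1) 0 / max t (|c| + 1)⁻¹

theorem continuous_negPartFun (c : ℝ) : Continuous (negPartFun c) := by
  unfold negPartFun
  refine Continuous.div (by fun_prop) (by fun_prop) fun t => ?_
  have : 0 < (|c| + 1)⁻¹ := by positivity
  exact (lt_max_of_lt_right this).ne'

theorem negPartFun_nonneg (c t : ℝ) : 0 ≤ negPartFun c t := by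
  unfold negPartFun; positivity

/-- The negative spectrum of the operator corresponds to `c * t > 1`, which stays away from `t = 0`.
The `+ 1` keeps the threshold meaningful also for `c = 0`. -/
theorem inv_lt_of_one_lt_mul {c t : ℝ} (ht : 0 ≤ t) (h : 1 < c * t) : (|c| + 1)⁻¹ < t := by
  have ht' : 0 < t := lt_of_le_of_ne ht fun h0 => by rw [← h0] at h; norm_num at h
  rw [inv_lt_iff_one_lt_mul₀ (by positivity)]
  nlinarith [le_abs_self c]

theorem negPartFun_eq {c t : ℝ} (ht : 0 ≤ t) : max (c * t - 1) 0 / t = negPartFun c t := by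
  unfold negPartFun
  rcases le_or_gt (c * t) 1 with h | h
  · rw [max_eq_right (by linarith : c * t - 1 ≤ 0), zero_div, zero_div]
  · rw [max_eq_left (inv_lt_of_one_lt_mul ht h).le]

/-- A continuous cutoff to the region where `negPartFun c` is positive. -/
noncomputable def negPartCutoff (c ε t : ℝ) : ℝ := min 1 (negPartFun c t / ε)

theorem continuous_negPartCutoff (c ε : ℝ) : Continuous (negPartCutoff c ε) := by
  have := continuous_negPartFun c
  unfold negPartCutoff
  fun_prop

theorem negPartCutoff_mem {c ε : ℝ} (hε : 0 < ε) (t : ℝ) :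
    0 ≤ negPartCutoff c ε t ∧ negPartCutoff c ε t ≤ 1 :=
  ⟨le_min zero_le_one (div_nonneg (negPartFun_nonneg c t) hε.le), min_le_left _ _⟩

theorem continuous_negPartCutoff_div (c ε : ℝ) :
    Continuous fun t => negPartCutoff c ε t / max t (|c| + 1)⁻¹ := by
  refine Continuous.div (continuous_negPartCutoff c ε) (by fun_prop) fun t => ?_
  have : 0 < (|c| + 1)⁻¹ := by positivity
  exact (lt_max_of_lt_right this).ne'

theorem negPartCutoff_eq_zero {c ε t : ℝ} (h : c * t ≤ 1) : negPartCutoff c ε t = 0 := by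
  rw [negPartCutoff, negPartFun, max_eq_right (by linarith : c * t - 1 ≤ 0), zero_div, zero_div]
  norm_num

/-- In the functional calculus this reads `R * Q = K`, which places the range of the cutoff `K` in
the operator domain. -/
theorem mul_negPartCutoff_div {c ε t : ℝ} (ht : 0 ≤ t) :
    t * (negPartCutoff c ε t / max t (|c| + 1)⁻¹) = negPartCutoff c ε t := by
  rcases le_or_gt (c * t) 1 with h | h
  · rw [negPartCutoff_eq_zero h]; simp
  · have h1 := inv_lt_of_one_lt_mul ht h
    have h2 : 0 < (|c| + 1)⁻¹ := by positivity
    rw [max_eq_left h1.le, mul_div_cancel₀ _ (h2.trans h1).ne']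

/-- Let `g` be the negative part and `k` the cutoff. Where `g > 0` one has `g = c - 1/t`, and the
main term on the right is `k² g`. If `g ≥ ε`, then `k = 1`; otherwise `g` itself is at most `ε`. -/
theorem negPartFun_le {c ε t : ℝ} (hε : 0 < ε) (ht : 0 ≤ t) :
    negPartFun c t ≤ negPartCutoff c ε t * (c * negPartCutoff c ε t -
      negPartCutoff c ε t / max t (|c| + 1)⁻¹) + ε := by
  rcases le_or_gt (c * t) 1 with h | h
  · rw [negPartCutoff_eq_zero h, negPartFun, max_eq_right (by linarith : c * t - 1 ≤ 0), zero_div]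
    simpa using hε.le
  · have h1 := inv_lt_of_one_lt_mul ht h
    have h2 : 0 < (|c| + 1)⁻¹ := by positivity
    have ht' : t ≠ 0 := (h2.trans h1).ne'
    rw [max_eq_left h1.le]
    have hg : negPartFun c t = c - 1 / t := by
      rw [negPartFun, max_eq_left h1.le, max_eq_left (by linarith)]
      field_simp
    have e : negPartCutoff c ε t * (c * negPartCutoff c ε t - negPartCutoff c ε t / t) =
        negPartCutoff c ε t ^ 2 * negPartFun c t := by
      rw [hg]; field_simp
    rw [e]
    have h0 := negPartFun_nonneg c t
    rcases le_total 1 (negPartFun c t / ε) with h3 | h3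
    · rw [negPartCutoff, min_eq_left h3]
      linarith
    · rw [div_le_one hε] at h3
      have := mul_nonneg (sq_nonneg (negPartCutoff c ε t)) h0
      linarith

variable {H : Type*} [NormedAddCommGroup H] [InnerProductSpace ℂ H] [CompleteSpace H]

theorem negPartOfShiftedInverse_eq {c : ℝ} {R : H →L[ℂ] H} (hR : R.IsPositive) :
    negPartOfShiftedInverse c R = cfc (negPartFun c) R := by
  refine cfc_congr fun t ht => negPartFun_eq ?_
  exact spectrum_nonneg_of_nonneg ((ContinuousLinearMap.nonneg_iff_isPositive R).2 hR) ht

/-- Approximate spectral vectors: the operator `K` is a smoothed spectral projection of `A` onto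
the negative axis, and `Q = (A + c) K`. -/
theorem exists_cutoff_operators {c : ℝ} {R : H →L[ℂ] H} (hR : R.IsPositive) {ε : ℝ} (hε : 0 < ε) :
    ∃ K Q : H →L[ℂ] H, ContinuousLinearMap.adjoint K = K ∧ ‖K‖ ≤ 1 ∧ R * Q = K ∧
      ∀ x, (inner ℂ x (negPartOfShiftedInverse c R x)).re ≤
        -(inner ℂ (K x) (Q x - (c : ℂ) • K x)).re + ε * ‖x‖ ^ 2 := by
  have hR0 : 0 ≤ R := (ContinuousLinearMap.nonneg_iff_isPositive R).2 hR
  have hspec : ∀ t ∈ spectrum ℝ R, 0 ≤ t := fun t ht => spectrum_nonneg_of_nonneg hR0 ht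
  have hRsa : IsSelfAdjoint R := hR.isSelfAdjoint
  set k := negPartCutoff c ε with hk
  set q := fun t => negPartCutoff c ε t / max t (|c| + 1)⁻¹ with hq
  have ck : Continuous k := continuous_negPartCutoff c ε
  have cq : Continuous q := continuous_negPartCutoff_div c ε
  have cg : Continuous (negPartFun c) := continuous_negPartFun c
  refine ⟨cfc k R, cfc q R, ?_, ?_, ?_, ?_⟩
  · exact (cfc_predicate k R : IsSelfAdjoint _)
  · refine norm_cfc_le zero_le_one fun t ht => ?_
    rw [Real.norm_of_nonneg (negPartCutoff_mem hε t).1]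
    exact (negPartCutoff_mem hε t).2
  · have h1 : cfc (fun t => t * q t) R = R * cfc q R := by
      rw [cfc_mul (fun t => t) q R (by fun_prop) cq.continuousOn, cfc_id' ℝ R]
    rw [← h1]
    exact cfc_congr fun t ht => mul_negPartCutoff_div (hspec t ht)
  · intro x
    have hsa : ContinuousLinearMap.adjoint (cfc k R) = cfc k R :=
      (cfc_predicate k R : IsSelfAdjoint _)
    have h1 : cfc (negPartFun c) R ≤ cfc (fun t => k t * (c * k t - q t) + ε) R := by
      refine cfc_mono (fun t ht => negPartFun_le hε (hspec t ht)) cg.continuousOn ?_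
      exact Continuous.continuousOn (by fun_prop)
    have h2 : cfc (fun t => k t * (c * k t - q t) + ε) R =
        cfc k R * (c • cfc k R - cfc q R) + algebraMap ℝ (H →L[ℂ] H) ε := by
      rw [cfc_add_const ε (fun t => k t * (c * k t - q t)) R
          (Continuous.continuousOn (by fun_prop)),
        cfc_mul k (fun t => c * k t - q t) R ck.continuousOn
          (Continuous.continuousOn (by fun_prop)),
        cfc_sub (fun t => c * k t) q R (Continuous.continuousOn (by fun_prop)) cq.continuousOn,
        cfc_const_mul c k R ck.continuousOn]
    rw [h2] at h1
    have h3 := re_inner_le_of_le h1 x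
    rw [negPartOfShiftedInverse_eq hR]
    refine h3.trans (le_of_eq ?_)
    rw [add_apply, inner_add_right, mul_apply_eq_comp]
    have e1 : inner ℂ x (cfc k R ((c • cfc k R - cfc q R) x)) =
        -inner ℂ (cfc k R x) (cfc q R x - (c : ℂ) • cfc k R x) := by
      rw [← ContinuousLinearMap.adjoint_inner_left, hsa, ← inner_neg_right, neg_sub, sub_apply,
        smul_apply, Complex.coe_smul]
    have e2 : (algebraMap ℝ (H →L[ℂ] H) ε) x = (ε : ℂ) • x := by
      rw [Algebra.algebraMap_eq_smul_one, smul_apply, one_apply_eq_self,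
        Complex.coe_smul]
    rw [e1, e2, inner_smul_right, Complex.add_re, Complex.neg_re, Complex.re_ofReal_mul]
    congr 2
    exact inner_self_eq_norm_sq (𝕜 := ℂ) x

/-- Move the self-adjoint `K` to the other side and use Bessel's inequality for `b`. -/
theorem isBesselFamily_of_contraction {ι : Type*} {b : ι → H} (hb : Orthonormal ℂ b)
    (s : Finset ι) {K : H →L[ℂ] H} (hK : ContinuousLinearMap.adjoint K = K) (hK1 : ‖K‖ ≤ 1) :
    IsBesselFamily fun i : s => K (b i) := by
  intro f
  have h1 : ∀ i : s, ‖inner ℂ (K (b i)) f‖ ^ 2 = ‖inner ℂ (b i) (K f)‖ ^ 2 := by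
    intro i
    rw [← ContinuousLinearMap.adjoint_inner_right, hK]
  simp_rw [h1]
  rw [Finset.sum_coe_sort s fun i => ‖inner ℂ (b i) (K f)‖ ^ 2]
  refine (hb.sum_inner_products_le (K f)).trans ?_
  have : ‖K f‖ ≤ ‖f‖ := by
    calc ‖K f‖ ≤ ‖K‖ * ‖f‖ := K.le_opNorm f
      _ ≤ ‖f‖ := mul_le_of_le_one_left (norm_nonneg _) hK1
  gcongr

theorem re_inner_negPart_nonneg {c : ℝ} {R : H →L[ℂ] H} (hR : R.IsPositive) (x : H) :
    0 ≤ (inner ℂ x (negPartOfShiftedInverse c R x)).re := by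
  rw [negPartOfShiftedInverse_eq hR]
  have h : 0 ≤ cfc (negPartFun c) R := cfc_nonneg fun t _ => negPartFun_nonneg c t
  simpa using re_inner_le_of_le h x

end FunctionalCalculus

/-! ### From the variational inequality to the trace -/

theorem sum_negPart_le {ι : Type*} {b : ι → L2Plane} (hb : Orthonormal ℂ b) {B : ℝ} (hB : 0 < B)
    {V : Plane → ℝ} (hV : AEMeasurable V volume) (hfin : ∫⁻ x, levelSum B (V x) ≠ ⊤) {c : ℝ}
    {R : L2Plane →L[ℂ] L2Plane} (hR : IsShiftedInverse (landauGraph B V) c R) (s : Finset ι) :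
    ∑ i ∈ s, (inner ℂ (b i) (negPartOfShiftedInverse c R (b i))).re ≤
      (3 * (ENNReal.ofReal (B / (2 * Real.pi)) * ∫⁻ x, levelSum B (V x))).toReal := by
  refine le_of_forall_pos_le_add fun ε hε => ?_
  -- The cutoff loses `δ` for each of the finitely many unit vectors `b i`.
  set δ := ε / (s.card + 1) with hδ
  have hδ0 : 0 < δ := by positivity
  obtain ⟨K, Q, hK, hK1, hRQ, hneg⟩ := exists_cutoff_operators (c := c) hR.1 hδ0
  -- Since `K (b i) = R (Q (b i))`, the vector lies in the operator domain, so the quadratic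
  -- expression supplied by the functional calculus is the value of the form.
  have hmem : ∀ i, (K (b i), Q (b i) - (c : ℂ) • K (b i)) ∈ landauGraph B V := fun i =>
    (hR.2 (Q (b i)) (K (b i))).2 (congrArg (fun A : L2Plane →L[ℂ] L2Plane => A (b i)) hRQ)
  have h1 := neg_sum_landauForm_le hB hV hfin (isBesselFamily_of_contraction hb s hK hK1)
    fun i => (hmem i).1
  rw [Finset.sum_coe_sort s fun i => (landauForm B V (K (b i)) (K (b i))).re] at h1
  have h2 : ∀ i ∈ s, (inner ℂ (b i) (negPartOfShiftedInverse c R (b i))).re ≤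
      -(landauForm B V (K (b i)) (K (b i))).re + δ := by
    intro i _
    have := hneg (b i)
    rw [hb.1 i, one_pow, mul_one, ← (hmem i).2 _ (hmem i).1] at this
    exact this
  refine (Finset.sum_le_sum h2).trans ?_
  rw [Finset.sum_add_distrib, Finset.sum_neg_distrib, Finset.sum_const, nsmul_eq_mul]
  have h3 : (s.card : ℝ) * δ ≤ ε := by
    rw [hδ, mul_div_assoc', div_le_iff₀ (by positivity)]
    nlinarith
  linarith

theorem theorem1p1 {ι : Type*} (b : HilbertBasis ι ℂ L2Plane) (B : ℝ) (hB : 0 < B)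
    (V : Plane → ℝ) (hV : AEMeasurable V volume) :
    traceNegPart b (landauGraph B V) ≤
      3 * (ENNReal.ofReal (B / (2 * Real.pi)) *
        ∑' m : ℕ, ∫⁻ x : Plane, ENNReal.ofReal (max (-((2 * (m : ℝ) + 1) * B + V x)) 0)) := by
  have hpi := Real.pi_pos
  rw [← lintegral_levelSum B hV]
  by_cases hfin : ∫⁻ x, levelSum B (V x) = ⊤
  · have h0 : ENNReal.ofReal (B / (2 * Real.pi)) ≠ 0 :=
      (ENNReal.ofReal_pos.2 (by positivity)).ne'
    rw [hfin, ENNReal.mul_top h0, ENNReal.mul_top (by norm_num)]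
    exact le_top
  obtain ⟨c, R, hR⟩ := exists_isShiftedInverse hB hV hfin
  have hex : ∃ p : ℝ × (L2Plane →L[ℂ] L2Plane), IsShiftedInverse (landauGraph B V) p.1 p.2 :=
    ⟨(c, R), hR⟩
  -- The bound on partial traces holds for every admissible shift, in particular for the one chosen
  -- in the definition; independence of the shift is not needed.
  rw [traceNegPart, dif_pos hex, ENNReal.tsum_eq_iSup_sum]
  refine iSup_le fun s => ?_
  rw [← ENNReal.ofReal_sum_of_nonneg fun i _ => re_inner_negPart_nonneg hex.choose_spec.1 (b i)]
  exact ENNReal.ofReal_le_of_le_toReal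
    (sum_negPart_le b.orthonormal hB hV hfin hex.choose_spec s)
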